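/- Let $A$ be a $C^*$-algebra. An associative Hilbert $C^*$-bimodule over $A$ is a Banach space $M$ that is an $A$-$A$-bimodule, with $AM$ and $MA$ densely spanning $M$, and that carries two definite $A$-valued inner products, ${}_A\langle\cdot,\cdot\rangle$ (left Hilbert $C^*$-module structure, linear in the first variable) and $\langle\cdot,\cdot\rangle_A$ (right Hilbert $C^*$-module structure, linear in the second variable), such that $\langle am,m'\rangle_A=\langle m,a^*m'\rangle_A$ and ${}_A\langle mb,m'\rangle={}_A\langle m,m'b^*\rangle$, the norm of $M$ is equivalent to $\|{}_A\langle m,m\rangle\|^{1/2}$ and to $\|\langle m,m\rangle_A\|^{1/2}$, and ${}_A\langle m,n\rangle r=m\langle n,r\rangle_A$ for all $m,n,r\in M$. No fullness is required. Let $S(A)$ be the set of isomorphism classes of such bimodules (isomorphisms are linear bijections that commute with both actions and preserve both inner products), with the product $[M]\cdot[N]=[M\otimes_A N]$, where $M\otimes_A N$ is the Hausdorff completion of the algebraic tensor product with respect to the inner products determined by $${}_A\langle m\otimes n,m'\otimes n'\rangle={}_A\langle m,\,m'\,{}_A\langle n',n\rangle\rangle,\qquad \langle m\otimes n,m'\otimes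 n'\rangle_A=\langle n,\,\langle m,m'\rangle_A\,n'\rangle_A .$$ Then for every integer $n\ge 0$ the semigroup $S(\mathbb C^n)$ is isomorphic to the symmetric inverse monoid on $\{1,\dots,n\}$, i.e. to the semigroup of all partial bijections of $\{1,\dots,n\}$ (bijections between subsets of $\{1,\dots,n\}$) under composition: there is a bijection from $S(\mathbb C^n)$ onto the set of partial bijections that takes products to products. -/

import Mathlib

universe u

namespace CStarBimod

/-- Positivity of an element of a C*-algebra. -/
def IsPos {D : Type*} [NonUnitalCStarAlgebra D] (d : D) : Prop :=
  ∃ c : D, d = star c * c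

section Pos
variable {D : Type*} [NonUnitalCStarAlgebra D]

theorem isPos_iff [PartialOrder D] [StarOrderedRing D] {d : D} : IsPos d ↔ 0 ≤ d :=
  CStarAlgebra.nonneg_iff_eq_star_mul_self.symm

theorem IsPos.add {x y : D} (hx : IsPos x) (hy : IsPos y) : IsPos (x + y) := by
  let := CStarAlgebra.spectralOrder D
  have := CStarAlgebra.spectralOrderedRing D
  rw [isPos_iff] at *
  exact add_nonneg hx hy

theorem isPos_zero : IsPos (0 : D) := ⟨0, by simp⟩

theorem IsPos.sum {ι : Type*} (s : Finset ι) {f : ι → D} (h : ∀ i ∈ s, IsPos (f i)) :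
    IsPos (∑ i ∈ s, f i) := by
  classical
  induction s using Finset.induction_on with
  | empty => simpa using isPos_zero
  | insert a s ha ih =>
    rw [Finset.sum_insert ha]
    exact (h a (by simp)).add (ih fun i hi => h i (by simp [hi]))

theorem IsPos.norm_le {x y : D} (hx : IsPos x) (h : IsPos (y - x)) : ‖x‖ ≤ ‖y‖ := by
  let := CStarAlgebra.spectralOrder D
  have := CStarAlgebra.spectralOrderedRing D
  rw [isPos_iff] at *
  exact CStarAlgebra.norm_le_norm_of_nonneg_of_le hx (sub_nonneg.1 h)

theorem isClosed_isPos : IsClosed {d : D | IsPos d} := by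
  let := CStarAlgebra.spectralOrder D
  have := CStarAlgebra.spectralOrderedRing D
  simp only [isPos_iff]
  exact isClosed_Ici

theorem IsPos.star_eq {x : D} (hx : IsPos x) : star x = x := by
  obtain ⟨c, rfl⟩ := hx; simp

/-- Comparison of `star a * a` with its norm, inside the unitization. -/
theorem exists_norm_sq_sub (a : D) : ∃ (l : ℂ) (d : D), star l * l = ((‖a‖ ^ 2 : ℝ) : ℂ) ∧
    star l • d + l • star d + star d * d = - (star a * a) := by
  let := CStarAlgebra.spectralOrder D
  have := CStarAlgebra.spectralOrderedRing D
  have h1 : (0 : Unitization ℂ D) ≤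
      algebraMap ℝ (Unitization ℂ D) ‖(↑(star a * a) : Unitization ℂ D)‖ -
        (↑(star a * a) : Unitization ℂ D) := by
    rw [sub_nonneg]
    apply IsSelfAdjoint.le_algebraMap_norm_self
    simp [isSelfAdjoint_iff]
  obtain ⟨c, hc⟩ := CStarAlgebra.nonneg_iff_eq_star_mul_self.1 h1
  have h2 : algebraMap ℝ (Unitization ℂ D) ‖(↑(star a * a) : Unitization ℂ D)‖ =
      Unitization.inl (((‖a‖ ^ 2 : ℝ)) : ℂ) := by
    rw [Unitization.norm_inr, CStarRing.norm_star_mul_self, sq]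
    rfl
  rw [h2] at hc
  refine ⟨c.fst, c.snd, ?_, ?_⟩
  · have := congrArg (fun u : Unitization ℂ D => u.fst) hc
    simp only [sub_eq_add_neg, Unitization.fst_add, Unitization.fst_neg, Unitization.fst_inl,
      Unitization.fst_inr, Unitization.fst_mul, Unitization.fst_star, neg_zero, add_zero] at this
    exact this.symm
  · have := congrArg (fun u : Unitization ℂ D => u.snd) hc
    simp only [sub_eq_add_neg, Unitization.snd_add, Unitization.snd_neg, Unitization.snd_inl,
      Unitization.snd_inr, Unitization.snd_mul, Unitization.fst_star, Unitization.snd_star,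
      zero_add] at this
    exact this.symm

theorem exists_neg_test (G : D) (hG : star G = G) :
    ∃ p c : D, star p = p ∧ p * G * p = -(star c * c) ∧ (c = 0 → IsPos G) := by
  let := CStarAlgebra.spectralOrder D
  have := CStarAlgebra.spectralOrderedRing D
  have hG' : IsSelfAdjoint G := hG
  have hP0 : 0 ≤ G⁻ := CFC.negPart_nonneg G
  have hPs : star G⁻ = G⁻ := hP0.isSelfAdjoint
  have h3 : 0 ≤ G⁻ * G⁻ * G⁻ := by
    have := star_left_conjugate_nonneg hP0 G⁻
    rwa [hPs] at this
  obtain ⟨c, hc⟩ := CStarAlgebra.nonneg_iff_eq_star_mul_self.1 h3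
  refine ⟨G⁻, c, hPs, ?_, ?_⟩
  · rw [← hc]
    have h4 : G⁻ * G = -(G⁻ * G⁻) := by
      nth_rewrite 2 [← CFC.posPart_sub_negPart G hG']
      rw [mul_sub, CFC.negPart_mul_posPart, zero_sub]
    rw [h4, neg_mul]
  · rintro rfl
    have h4 : G⁻ * G⁻ = 0 := by
      rw [← CStarRing.star_mul_self_eq_zero_iff, star_mul, hPs, ← mul_assoc, hc]
      simp
    have h5 : G⁻ = 0 := by
      rw [← CStarRing.star_mul_self_eq_zero_iff, hPs, h4]
    rw [isPos_iff, ← CFC.posPart_sub_negPart G hG', h5, sub_zero]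
    exact CFC.posPart_nonneg G

theorem isPos_gram {k : ℕ} (K : Fin k → Fin k → D) (hK : ∀ i j, star (K i j) = K j i)
    (hpos : ∀ b : Fin k → D, IsPos (∑ i, ∑ j, star (b i) * K i j * b j)) :
    ∃ d : Fin k → Fin k → D, ∀ i j, K i j = ∑ l, star (d l i) * d l j := by
  let := CStarAlgebra.spectralOrder D
  have := CStarAlgebra.spectralOrderedRing D
  let G : CStarMatrix (Fin k) (Fin k) D := CStarMatrix.ofMatrix (Matrix.of K)
  have hG : star G = G := by
    ext i j
    simp [G, CStarMatrix.star_apply, hK]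
  obtain ⟨p, c, hp, hpc, h0⟩ := exists_neg_test G hG
  have hc0 : c = 0 := by
    have h2 : ∀ i, IsPos ((p * G * p) i i) := by
      intro i
      convert! hpos (fun j => p j i) using 1
      have hp' : ∀ j, p i j = star (p j i) := fun j => by
        conv_lhs => rw [← hp]
        rw [CStarMatrix.star_apply]
      rw [mul_assoc]
      simp only [CStarMatrix.mul_apply, Finset.mul_sum, hp' , mul_assoc]
      rfl
    have h3 : ∀ i, ∑ l, star (c l i) * c l i = 0 := by
      intro i
      have h4 := h2 i
      rw [hpc] at h4
      simp only [CStarMatrix.neg_apply, CStarMatrix.mul_apply, CStarMatrix.star_apply] at h4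
      have h5 : IsPos (∑ l, star (c l i) * c l i) := IsPos.sum _ fun l _ => ⟨_, rfl⟩
      rw [isPos_iff] at h4 h5
      exact le_antisymm (neg_nonneg.1 h4) h5
    ext l i
    have h6 := (Finset.sum_eq_zero_iff_of_nonneg (fun l _ => star_mul_self_nonneg (c l i))).1 (h3 i)
      l (Finset.mem_univ l)
    simpa using h6
  obtain ⟨c, hc⟩ := h0 hc0
  refine ⟨fun l i => c l i, fun i j => ?_⟩
  have := congrArg (fun M : CStarMatrix (Fin k) (Fin k) D => M i j) hc
  simpa [G, CStarMatrix.mul_apply, CStarMatrix.star_apply] using this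

end Pos

section Form
variable {D : Type*} [NonUnitalCStarAlgebra D] {E : Type*} [AddCommGroup E] [Module ℂ E]

/-- The seminorm of a positive `D`-valued sesquilinear form. -/
noncomputable def gauge (φ : E →ₗ⋆[ℂ] E →ₗ[ℂ] D) (x : E) : ℝ := √‖φ x x‖

variable (φ : E →ₗ⋆[ℂ] E →ₗ[ℂ] D)

theorem gauge_nonneg (x : E) : 0 ≤ gauge φ x := Real.sqrt_nonneg _

theorem gauge_sq (x : E) : gauge φ x ^ 2 = ‖φ x x‖ := Real.sq_sqrt (norm_nonneg _)

theorem gauge_smul (c : ℂ) (x : E) : gauge φ (c • x) = ‖c‖ * gauge φ x := by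
  unfold gauge
  simp only [map_smulₛₗ, LinearMap.smul_apply, norm_smul]
  rw [← mul_assoc, Real.sqrt_mul (by positivity)]
  simp

theorem norm_smul_add_le {a b r : ℝ} (ha : 0 ≤ a) (hb : 0 ≤ b)
    (h : ∀ t : ℝ, 0 < t → r ≤ (1 + t) * a ^ 2 + (1 + t⁻¹) * b ^ 2) : r ≤ (a + b) ^ 2 := by
  have h1 : ∀ ε : ℝ, 0 < ε → r ≤ ((a + ε) + (b + ε)) ^ 2 := by
    intro ε hε
    have ha' : 0 < a + ε := by linarith
    have hb' : 0 < b + ε := by linarith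
    have := h ((b + ε) / (a + ε)) (by positivity)
    refine this.trans ?_
    have e : ((a + ε) + (b + ε)) ^ 2 = (1 + (b + ε) / (a + ε)) * (a + ε) ^ 2 +
        (1 + ((b + ε) / (a + ε))⁻¹) * (b + ε) ^ 2 := by
      field_simp
      ring
    rw [e]
    gcongr <;> linarith
  have h2 : Filter.Tendsto (fun ε : ℝ => ((a + ε) + (b + ε)) ^ 2) (nhdsWithin 0 (Set.Ioi 0))
      (nhds ((a + b) ^ 2)) := by
    have : Continuous (fun ε : ℝ => ((a + ε) + (b + ε)) ^ 2) := by fun_prop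
    simpa using (this.tendsto 0).mono_left nhdsWithin_le_nhds
  exact ge_of_tendsto h2 (by filter_upwards [self_mem_nhdsWithin] with ε hε using h1 ε hε)

theorem gauge_add_le {φ : E →ₗ⋆[ℂ] E →ₗ[ℂ] D} (hφ : ∀ x, IsPos (φ x x)) (x y : E) : gauge φ (x + y) ≤ gauge φ x + gauge φ y := by
  refine abs_le_of_sq_le_sq' ?_ (add_nonneg (gauge_nonneg _ _) (gauge_nonneg _ _)) |>.2
  refine norm_smul_add_le (gauge_nonneg _ _) (gauge_nonneg _ _) fun t ht => ?_
  have ht' : ((√t : ℝ) : ℂ) ≠ 0 := by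
    simpa using (Real.sqrt_pos.2 ht).ne'
  have hsq : ((√t : ℝ) : ℂ) * ((√t : ℝ) : ℂ) = t := by
    rw [← Complex.ofReal_mul, Real.mul_self_sqrt ht.le]
  have key : IsPos (((1 + t : ℝ) : ℂ) • φ x x + ((1 + t⁻¹ : ℝ) : ℂ) • φ y y
      - φ (x + y) (x + y)) := by
    have := hφ (((√t : ℝ) : ℂ) • x - ((√t : ℝ) : ℂ)⁻¹ • y)
    convert! this using 1
    simp only [map_add, map_sub, map_smulₛₗ, LinearMap.add_apply, LinearMap.sub_apply,
      LinearMap.smul_apply, smul_sub, smul_smul, map_inv₀, Complex.conj_ofReal, RingHom.id_apply,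
      mul_inv_cancel₀ ht', inv_mul_cancel₀ ht', hsq, ← mul_inv]
    push_cast
    module
  have h1 := (hφ (x + y)).norm_le key
  rw [gauge_sq, gauge_sq, gauge_sq]
  refine h1.trans ((norm_add_le _ _).trans ?_)
  rw [norm_smul, norm_smul, Complex.norm_real, Complex.norm_real, Real.norm_of_nonneg (by positivity),
    Real.norm_of_nonneg (by positivity)]

theorem norm_form_le {φ : E →ₗ⋆[ℂ] E →ₗ[ℂ] D} (hφ : ∀ x, IsPos (φ x x)) (x y : E) : ‖φ x y‖ ≤ 4 * (gauge φ x * gauge φ y) := by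
  have h0 : ∀ x y : E, ‖φ x y‖ ≤ (gauge φ x + gauge φ y) ^ 2 := by
    intro x y
    have hb : ∀ c : ℂ, ‖c‖ = 1 → ‖φ (x + c • y) (x + c • y)‖ ≤ (gauge φ x + gauge φ y) ^ 2 := by
      intro c hc
      rw [← gauge_sq]
      have := gauge_add_le hφ x (c • y)
      rw [gauge_smul, hc, one_mul] at this
      exact pow_le_pow_left₀ (gauge_nonneg _ _) this 2
    have e : (4 : ℂ) • φ x y = φ (x + (1 : ℂ) • y) (x + (1 : ℂ) • y)
        - φ (x + (-1 : ℂ) • y) (x + (-1 : ℂ) • y)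
        + (-Complex.I) • φ (x + Complex.I • y) (x + Complex.I • y)
        + Complex.I • φ (x + (-Complex.I) • y) (x + (-Complex.I) • y) := by
      simp only [map_add, map_smulₛₗ, LinearMap.add_apply, LinearMap.smul_apply, smul_add,
        smul_smul, RingHom.id_apply, map_neg, Complex.conj_I, map_one]
      ring_nf
      simp only [Complex.I_sq]
      have : Complex.I ^ 3 = - Complex.I := by rw [pow_succ, Complex.I_sq]; ring
      simp only [this]
      module
    have h4 : ‖(4 : ℂ) • φ x y‖ ≤ 4 * (gauge φ x + gauge φ y) ^ 2 := by
      rw [e]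
      refine (norm_add_le _ _).trans ?_
      refine (add_le_add ((norm_add_le _ _).trans (add_le_add (norm_sub_le _ _) le_rfl)) le_rfl).trans ?_
      rw [norm_smul, norm_smul]
      have h1 := hb 1 (by simp)
      have h2 := hb (-1) (by simp)
      have h3 := hb Complex.I (by simp)
      have h4 := hb (-Complex.I) (by simp)
      simp only [norm_neg, Complex.norm_I, one_mul]
      linarith
    rw [norm_smul] at h4
    norm_num at h4
    linarith
  have h1 : ∀ ε : ℝ, 0 < ε → ‖φ x y‖ ≤ 4 * ((gauge φ x + ε) * (gauge φ y + ε)) := by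
    intro ε hε
    have hx : 0 < gauge φ x + ε := by linarith [gauge_nonneg φ x]
    have hy : 0 < gauge φ y + ε := by linarith [gauge_nonneg φ y]
    have := h0 (((gauge φ x + ε)⁻¹ : ℝ) • x) (((gauge φ y + ε)⁻¹ : ℝ) • y)
    have e1 : ∀ (r : ℝ) (z : E), r • z = (r : ℂ) • z := fun r z => by simp
    rw [e1, e1, gauge_smul, gauge_smul] at this
    simp only [map_smulₛₗ, LinearMap.smul_apply, norm_smul, RingHom.id_apply, Complex.conj_ofReal,
      Complex.norm_real, norm_inv, Real.norm_of_nonneg hx.le, Real.norm_of_nonneg hy.le] at this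
    have h3 : (gauge φ x + ε)⁻¹ * gauge φ x ≤ 1 := by
      rw [inv_mul_le_one₀ hx]; linarith
    have h4 : (gauge φ y + ε)⁻¹ * gauge φ y ≤ 1 := by
      rw [inv_mul_le_one₀ hy]; linarith
    have h5 : ((gauge φ x + ε)⁻¹ * gauge φ x + (gauge φ y + ε)⁻¹ * gauge φ y) ^ 2 ≤ 2 ^ 2 := by
      have := gauge_nonneg φ x
      have := gauge_nonneg φ y
      apply pow_le_pow_left₀ (by positivity)
      linarith
    have h6 := this.trans h5
    rw [← mul_assoc, ← mul_inv, mul_comm, ← div_eq_mul_inv, div_le_iff₀ (by positivity)] at h6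
    nlinarith
  have h2 : Filter.Tendsto (fun ε : ℝ => 4 * ((gauge φ x + ε) * (gauge φ y + ε)))
      (nhdsWithin 0 (Set.Ioi 0)) (nhds (4 * (gauge φ x * gauge φ y))) := by
    have : Continuous (fun ε : ℝ => 4 * ((gauge φ x + ε) * (gauge φ y + ε))) := by fun_prop
    simpa using (this.tendsto 0).mono_left nhdsWithin_le_nhds
  exact ge_of_tendsto h2 (by filter_upwards [self_mem_nhdsWithin] with ε hε using h1 ε hε)

theorem norm_le_of_functional {D' : Type*} [NonUnitalCStarAlgebra D'] (L : D' →ₗ[ℂ] D) (v : D)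
    (hL : ∀ (l : ℂ) (d : D'), IsPos ((star l * l) • v + L (star l • d + l • star d + star d * d)))
    (a : D') : ‖L (star a * a)‖ ≤ ‖a‖ ^ 2 * ‖v‖ := by
  obtain ⟨l, d, h1, h2⟩ := exists_norm_sq_sub a
  have h3 := hL l d
  rw [h1, h2, map_neg, ← sub_eq_add_neg] at h3
  have h4 : IsPos (L (star a * a)) := by
    have := hL 0 a
    simpa using this
  refine (h4.norm_le h3).trans ?_
  rw [norm_smul, Complex.norm_real, Real.norm_of_nonneg (by positivity)]

end Form

/-- Algebraic data of a Hilbert `A`-`B`-bimodule on a complex vector space `E`, before any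
completeness, definiteness, density or associativity requirement.  `lsmul a m` is `a m`,
`rsmul b m` is `m b`, `linner m n` is the `A`-valued inner product (linear in the first variable),
`rinner m n` the `B`-valued one (linear in the second variable). The algebras need not be unital,
so that the actions are given as bilinear maps. -/
structure PreHilbertBimodule (A B E : Type*) [NonUnitalCStarAlgebra A] [NonUnitalCStarAlgebra B]
    [AddCommGroup E] [Module ℂ E] where
  lsmul : A →ₗ[ℂ] E →ₗ[ℂ] E
  rsmul : B →ₗ[ℂ] E →ₗ[ℂ] E
  linner : E →ₗ[ℂ] E →ₗ⋆[ℂ] A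
  rinner : E →ₗ⋆[ℂ] E →ₗ[ℂ] B
  mul_lsmul : ∀ a a' m, lsmul (a * a') m = lsmul a (lsmul a' m)
  mul_rsmul : ∀ b b' m, rsmul (b * b') m = rsmul b' (rsmul b m)
  lsmul_rsmul : ∀ a b m, rsmul b (lsmul a m) = lsmul a (rsmul b m)
  linner_lsmul : ∀ a m n, linner (lsmul a m) n = a * linner m n
  star_linner : ∀ m n, star (linner m n) = linner n m
  linner_self : ∀ m, IsPos (linner m m)
  rinner_rsmul : ∀ b m n, rinner m (rsmul b n) = rinner m n * b
  star_rinner : ∀ m n, star (rinner m n) = rinner n m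
  rinner_self : ∀ m, IsPos (rinner m m)
  rinner_lsmul : ∀ a m n, rinner (lsmul a m) n = rinner m (lsmul (star a) n)
  linner_rsmul : ∀ b m n, linner (rsmul b m) n = linner m (rsmul (star b) n)

namespace PreHilbertBimodule

variable {A B E : Type*} [NonUnitalCStarAlgebra A] [NonUnitalCStarAlgebra B]
    [AddCommGroup E] [Module ℂ E] (P : PreHilbertBimodule A B E)

/-- The seminorm `‖⟨m, m⟩_B‖ ^ (1 / 2)`. -/
noncomputable def rnorm (m : E) : ℝ := gauge P.rinner m

/-- The seminorm `‖_A⟨m, m⟩‖ ^ (1 / 2)`. -/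
noncomputable def lnorm (m : E) : ℝ := gauge P.linner.flip m

theorem linner_lsmul_right (a : A) (m n : E) :
    P.linner m (P.lsmul a n) = P.linner m n * star a := by
  rw [← P.star_linner, P.linner_lsmul, star_mul, P.star_linner]

theorem rinner_rsmul_left (b : B) (m n : E) :
    P.rinner (P.rsmul b m) n = star b * P.rinner m n := by
  rw [← P.star_rinner, P.rinner_rsmul, star_mul, P.star_rinner]

theorem rinner_lsmul_right (a : A) (m n : E) :
    P.rinner m (P.lsmul a n) = P.rinner (P.lsmul (star a) m) n := by
  rw [P.rinner_lsmul, star_star]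

theorem linner_rsmul_right (b : B) (m n : E) :
    P.linner m (P.rsmul b n) = P.linner (P.rsmul (star b) m) n := by
  rw [P.linner_rsmul, star_star]

theorem rnorm_sq (m : E) : P.rnorm m ^ 2 = ‖P.rinner m m‖ := gauge_sq _ _

theorem lnorm_sq (m : E) : P.lnorm m ^ 2 = ‖P.linner m m‖ := gauge_sq _ _

theorem rnorm_nonneg (m : E) : 0 ≤ P.rnorm m := gauge_nonneg _ _

theorem lnorm_nonneg (m : E) : 0 ≤ P.lnorm m := gauge_nonneg _ _

theorem rnorm_zero : P.rnorm 0 = 0 := by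
  have := gauge_smul P.rinner 0 0
  simpa [rnorm] using this

theorem rnorm_neg (m : E) : P.rnorm (-m) = P.rnorm m := by
  have := gauge_smul P.rinner (-1) m
  simpa [rnorm] using this

theorem norm_rinner_le (m n : E) : ‖P.rinner m n‖ ≤ 4 * (P.rnorm m * P.rnorm n) :=
  norm_form_le P.rinner_self m n

theorem norm_linner_le (m n : E) : ‖P.linner m n‖ ≤ 4 * (P.lnorm m * P.lnorm n) := by
  rw [mul_comm (P.lnorm m)]
  exact norm_form_le (φ := P.linner.flip) P.linner_self n m

/-- `A` acts by operators that are bounded for the `B`-valued inner product. -/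
theorem rnorm_lsmul_le (a : A) (m : E) : P.rnorm (P.lsmul a m) ≤ ‖a‖ * P.rnorm m := by
  refine (abs_le_of_sq_le_sq' ?_ (mul_nonneg (norm_nonneg _) (P.rnorm_nonneg _))).2
  rw [mul_pow, rnorm_sq, rnorm_sq, P.rinner_lsmul, ← P.mul_lsmul]
  refine norm_le_of_functional ((P.rinner m).comp (P.lsmul.flip m)) _ (fun l d => ?_) a
  have := P.rinner_self (l • m + P.lsmul d m)
  convert! this using 1
  simp only [map_add, map_smulₛₗ, LinearMap.add_apply, LinearMap.smul_apply, P.rinner_lsmul,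
    LinearMap.comp_apply, LinearMap.flip_apply, P.mul_lsmul, RingHom.id_apply, smul_add, smul_smul]
  simp only [← starRingEnd_apply]
  rw [mul_comm]
  abel

/-- `B` acts by operators that are bounded for the `A`-valued inner product. -/
theorem lnorm_rsmul_le (b : B) (m : E) : P.lnorm (P.rsmul b m) ≤ ‖b‖ * P.lnorm m := by
  refine (abs_le_of_sq_le_sq' ?_ (mul_nonneg (norm_nonneg _) (P.lnorm_nonneg _))).2
  rw [mul_pow, lnorm_sq, lnorm_sq, ← P.star_linner, P.linner_rsmul, ← P.mul_rsmul, norm_star,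
    ← P.star_linner, norm_star]
  have h := norm_le_of_functional ((P.linner.flip m).comp (P.rsmul.flip m)) (P.linner m m)
    (fun l d => ?_) (star b)
  · simpa using h
  have := P.linner_self ((star l) • m + P.rsmul (star d) m)
  convert! this using 1
  simp only [map_add, map_smulₛₗ, LinearMap.add_apply, LinearMap.smul_apply,
    P.linner_rsmul_right, star_star,
    LinearMap.comp_apply, LinearMap.flip_apply, P.mul_rsmul, RingHom.id_apply, smul_add, smul_smul]
  simp only [← starRingEnd_apply, Complex.conj_conj]
  rw [mul_comm]
  abel

theorem rnorm_rsmul_le (b : B) (m : E) : P.rnorm (P.rsmul b m) ≤ ‖b‖ * P.rnorm m := by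
  refine (abs_le_of_sq_le_sq' ?_ (mul_nonneg (norm_nonneg _) (P.rnorm_nonneg _))).2
  rw [mul_pow, rnorm_sq, rnorm_sq, P.rinner_rsmul, P.rinner_rsmul_left]
  refine (norm_mul_le _ _).trans ?_
  have := norm_mul_le (star b) (P.rinner m m)
  rw [norm_star] at this
  nlinarith [norm_nonneg b]

/-- Associativity of the two inner products up to null vectors. -/
def NullAssoc : Prop := ∀ x y z w,
  P.rinner w (P.lsmul (P.linner x y) z) = P.rinner w (P.rsmul (P.rinner y z) x) ∧
  P.linner w (P.lsmul (P.linner x y) z) = P.linner w (P.rsmul (P.rinner y z) x)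

theorem norm_cube {D : Type*} [NonUnitalCStarAlgebra D] {a : D} (ha : star a = a) :
    ‖a‖ ^ 3 ≤ ‖a * a * a‖ := by
  rcases eq_or_ne a 0 with rfl | h
  · simp
  have h0 : 0 < ‖a‖ := norm_pos_iff.2 h
  have h1 : ‖a * a‖ = ‖a‖ * ‖a‖ := by
    conv_lhs => rw [← ha]
    rw [ha]
    simpa [ha] using CStarRing.norm_star_mul_self (x := a)
  have h2 : ‖(a * a) * (a * a)‖ = ‖a * a‖ * ‖a * a‖ := by
    simpa [ha] using CStarRing.norm_star_mul_self (x := a * a)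
  have h3 := norm_mul_le (a * a * a) a
  rw [mul_assoc (a * a), h2, h1] at h3
  have : ‖a‖ ^ 3 * ‖a‖ ≤ ‖a * a * a‖ * ‖a‖ := by nlinarith
  exact le_of_mul_le_mul_right this h0

variable {P}

theorem NullAssoc.lnorm_eq (h : P.NullAssoc) (m : E) : P.lnorm m = P.rnorm m := by
  have aux : ∀ x y : ℝ, 0 ≤ x → 0 ≤ y → (x ^ 2) ^ 3 ≤ (y ^ 2 * x) ^ 2 → x ≤ y := by
    intro x y hx hy hxy
    rcases hx.eq_or_lt with rfl | hx
    · exact hy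
    by_contra! hlt
    have h4 : y ^ 4 < x ^ 4 := pow_lt_pow_left₀ hlt hy (by norm_num)
    nlinarith [pow_pos hx 2]
  apply le_antisymm
  · apply aux _ _ (P.lnorm_nonneg m) (P.rnorm_nonneg m)
    rw [P.lnorm_sq]
    refine (norm_cube (P.star_linner m m)).trans ?_
    have e : P.linner m m * P.linner m m * P.linner m m =
        P.linner (P.rsmul (P.rinner m m) m) (P.rsmul (P.rinner m m) m) := by
      have e1 : ∀ w, P.linner (P.lsmul (P.linner m m) m) w =
          P.linner (P.rsmul (P.rinner m m) m) w := fun w => by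
        rw [← P.star_linner, (h m m m w).2, P.star_linner]
      rw [← (h m m m _).2, ← e1, P.linner_lsmul, P.linner_lsmul_right, P.star_linner, mul_assoc]
    rw [e, ← P.lnorm_sq, P.rnorm_sq]
    exact pow_le_pow_left₀ (P.lnorm_nonneg _) (P.lnorm_rsmul_le _ _) 2
  · apply aux _ _ (P.rnorm_nonneg m) (P.lnorm_nonneg m)
    rw [P.rnorm_sq]
    refine (norm_cube (P.star_rinner m m)).trans ?_
    have e : P.rinner m m * P.rinner m m * P.rinner m m =
        P.rinner (P.lsmul (P.linner m m) m) (P.lsmul (P.linner m m) m) := by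
      have e1 : ∀ w, P.rinner (P.lsmul (P.linner m m) m) w =
          P.rinner (P.rsmul (P.rinner m m) m) w := fun w => by
        rw [← P.star_rinner, (h m m m w).1, P.star_rinner]
      rw [(h m m m _).1, e1, P.rinner_rsmul, P.rinner_rsmul_left, P.star_rinner]
    rw [e, ← P.rnorm_sq, P.lnorm_sq]
    exact pow_le_pow_left₀ (P.rnorm_nonneg _) (P.rnorm_lsmul_le _ _) 2

variable (P)

/-- The vector space `E` with the seminorm `‖⟨m, m⟩_B‖ ^ (1 / 2)`. -/
def Space (_P : PreHilbertBimodule A B E) : Type _ := E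

noncomputable instance : SeminormedAddCommGroup P.Space :=
  AddGroupSeminorm.toSeminormedAddCommGroup (E := E)
    { toFun := fun m => P.rnorm m
      map_zero' := P.rnorm_zero
      add_le' := fun m n => gauge_add_le P.rinner_self m n
      neg' := fun m => P.rnorm_neg m }

noncomputable instance : NormedSpace ℂ P.Space :=
  { (show Module ℂ E from inferInstance) with
    norm_smul_le := fun c m => (gauge_smul P.rinner c m).le }

/-- The Hausdorff completion of `E` with respect to the seminorm `‖⟨m, m⟩_B‖ ^ (1 / 2)`. -/
def Compl : Type _ := UniformSpace.Completion P.Space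

noncomputable instance : NormedAddCommGroup P.Compl :=
  inferInstanceAs (NormedAddCommGroup (UniformSpace.Completion P.Space))
noncomputable instance : NormedSpace ℂ P.Compl :=
  inferInstanceAs (NormedSpace ℂ (UniformSpace.Completion P.Space))
instance : CompleteSpace P.Compl :=
  inferInstanceAs (CompleteSpace (UniformSpace.Completion P.Space))

/-- The canonical map into the completion. -/
noncomputable def toCompl : E →ₗ[ℂ] P.Compl where
  toFun m := UniformSpace.Completion.coe' (α := P.Space) m
  map_add' m n := UniformSpace.Completion.coe_add (α := P.Space) m n
  map_smul' c m := UniformSpace.Completion.coe_smul (X := P.Space) c m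

theorem norm_toCompl (m : E) : ‖P.toCompl m‖ = P.rnorm m :=
  UniformSpace.Completion.norm_coe (E := P.Space) m

theorem denseRange_toCompl : DenseRange P.toCompl :=
  UniformSpace.Completion.denseRange_coe (α := P.Space)

end PreHilbertBimodule

/-- An associative Hilbert C*-bimodule, left over `A` and right over `B`: a Banach space with
commuting non-degenerate actions of `A` and `B` and inner products with values in `A` and in `B`
such that each algebra acts by (automatically bounded) adjointable operators for the inner product
with values in the other one, the norm is equivalent to both norms given by the inner products, and
`_A⟨m, n⟩ r = m ⟨n, r⟩_B`.  It is not required to be full. -/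
structure AssocHilbertBimodule (A B : Type u) [NonUnitalCStarAlgebra A]
    [NonUnitalCStarAlgebra B] where
  carrier : Type u
  [normedAddCommGroup : NormedAddCommGroup carrier]
  [normedSpace : NormedSpace ℂ carrier]
  [completeSpace : CompleteSpace carrier]
  form : PreHilbertBimodule A B carrier
  linner_definite : ∀ m, form.linner m m = 0 → m = 0
  rinner_definite : ∀ m, form.rinner m m = 0 → m = 0
  dense_lsmul : Dense (Submodule.span ℂ {x | ∃ a m, form.lsmul a m = x} : Set carrier)
  dense_rsmul : Dense (Submodule.span ℂ {x | ∃ b m, form.rsmul b m = x} : Set carrier)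
  norm_equiv_left : ∃ c C : ℝ, 0 < c ∧ ∀ m : carrier,
    c * ‖m‖ ≤ √‖form.linner m m‖ ∧ √‖form.linner m m‖ ≤ C * ‖m‖
  norm_equiv_right : ∃ c C : ℝ, 0 < c ∧ ∀ m : carrier,
    c * ‖m‖ ≤ √‖form.rinner m m‖ ∧ √‖form.rinner m m‖ ≤ C * ‖m‖
  assoc : ∀ m n r, form.lsmul (form.linner m n) r = form.rsmul (form.rinner n r) m

namespace AssocHilbertBimodule

variable {A B : Type u} [NonUnitalCStarAlgebra A] [NonUnitalCStarAlgebra B]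

instance (M : AssocHilbertBimodule A B) : NormedAddCommGroup M.carrier := M.normedAddCommGroup
instance (M : AssocHilbertBimodule A B) : NormedSpace ℂ M.carrier := M.normedSpace
instance (M : AssocHilbertBimodule A B) : CompleteSpace M.carrier := M.completeSpace

/-- An isomorphism of associative Hilbert C*-bimodules: a linear bijection that commutes with both
actions and preserves both inner products. -/
structure Iso (M N : AssocHilbertBimodule A B) where
  toEquiv : M.carrier ≃ₗ[ℂ] N.carrier
  map_lsmul : ∀ a m, toEquiv (M.form.lsmul a m) = N.form.lsmul a (toEquiv m)
  map_rsmul : ∀ b m, toEquiv (M.form.rsmul b m) = N.form.rsmul b (toEquiv m)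
  linner_map : ∀ m n, N.form.linner (toEquiv m) (toEquiv n) = M.form.linner m n
  rinner_map : ∀ m n, N.form.rinner (toEquiv m) (toEquiv n) = M.form.rinner m n

/-- The identity isomorphism. -/
def Iso.refl (M : AssocHilbertBimodule A B) : Iso M M :=
  ⟨LinearEquiv.refl ℂ _, fun _ _ => rfl, fun _ _ => rfl, fun _ _ => rfl, fun _ _ => rfl⟩

/-- The inverse isomorphism. -/
def Iso.symm {M N : AssocHilbertBimodule A B} (f : Iso M N) : Iso N M :=
  ⟨f.toEquiv.symm, fun a m => by rw [LinearEquiv.symm_apply_eq, f.map_lsmul]; simp,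
    fun a m => by rw [LinearEquiv.symm_apply_eq, f.map_rsmul]; simp,
    fun m n => by rw [← f.linner_map]; simp,
    fun m n => by rw [← f.rinner_map]; simp⟩

/-- Composition of isomorphisms. -/
def Iso.trans {M N L : AssocHilbertBimodule A B} (f : Iso M N) (g : Iso N L) : Iso M L :=
  ⟨f.toEquiv.trans g.toEquiv, fun a m => by simp [f.map_lsmul, g.map_lsmul],
    fun a m => by simp [f.map_rsmul, g.map_rsmul],
    fun m n => by simp [f.linner_map, g.linner_map],
    fun m n => by simp [f.rinner_map, g.rinner_map]⟩

end AssocHilbertBimodule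

section Extension

variable {E F : Type*} [AddCommGroup E] [Module ℂ E] [NormedAddCommGroup F] [NormedSpace ℂ F]
  {e : E →ₗ[ℂ] F}

/-- Two continuous maps agree if they agree on a dense subspace. -/
theorem dense_ext (he : DenseRange e) {Z : Type*} [TopologicalSpace Z] [T2Space Z] {f g : F → Z}
    (hf : Continuous f) (hg : Continuous g) (h : ∀ m, f (e m) = g (e m)) (x : F) : f x = g x :=
  he.induction_on (p := fun x => f x = g x) x (isClosed_eq hf hg) h

theorem form_bound {D : Type*} [NormedAddCommGroup D] [NormedSpace ℂ D]
    (φ : E →ₗ⋆[ℂ] E →ₗ[ℂ] D) (hφ : ∀ m n, ‖φ m n‖ ≤ 4 * (‖e m‖ * ‖e n‖)) (m : E) :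
    ∃ C, ∀ n, ‖φ m n‖ ≤ C * ‖e n‖ :=
  ⟨4 * ‖e m‖, fun n => by rw [mul_assoc]; exact hφ m n⟩

variable {D : Type*}

/-- Extension of a linear family of bounded linear maps along a dense linear map `e`. -/
noncomputable def extendAction [AddCommGroup D] [Module ℂ D] [CompleteSpace F] (he : DenseRange e)
    (f : D →ₗ[ℂ] E →ₗ[ℂ] E) (hf : ∀ d, ∃ C, ∀ m, ‖e (f d m)‖ ≤ C * ‖e m‖) :
    D →ₗ[ℂ] F →L[ℂ] F where
  toFun d := (e.comp (f d)).extendOfNorm e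
  map_add' d d' := ContinuousLinearMap.ext fun x => dense_ext he
    (f := (e.comp (f (d + d'))).extendOfNorm e)
    (g := fun x => (e.comp (f d)).extendOfNorm e x + (e.comp (f d')).extendOfNorm e x)
    (by fun_prop) (by fun_prop) (fun m => by
      rw [LinearMap.extendOfNorm_eq he (hf _), LinearMap.extendOfNorm_eq he (hf _),
        LinearMap.extendOfNorm_eq he (hf _)]
      simp) x
  map_smul' c d := ContinuousLinearMap.ext fun x => dense_ext he
    (f := (e.comp (f (c • d))).extendOfNorm e)
    (g := fun x => c • (e.comp (f d)).extendOfNorm e x)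
    (by fun_prop) (by fun_prop) (fun m => by
      rw [LinearMap.extendOfNorm_eq he (hf _), LinearMap.extendOfNorm_eq he (hf _)]
      simp) x

theorem extendAction_apply [AddCommGroup D] [Module ℂ D] [CompleteSpace F] (he : DenseRange e)
    (f : D →ₗ[ℂ] E →ₗ[ℂ] E) (hf : ∀ d, ∃ C, ∀ m, ‖e (f d m)‖ ≤ C * ‖e m‖) (d : D) (m : E) :
    extendAction he f hf d (e m) = e (f d m) :=
  LinearMap.extendOfNorm_eq (f := e.comp (f d)) he (hf d) m

variable [NormedAddCommGroup D] [NormedSpace ℂ D] [CompleteSpace D]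

/-- Extension of a bounded sesquilinear form in its second variable. -/
noncomputable def extendFormAux (he : DenseRange e)
    (φ : E →ₗ⋆[ℂ] E →ₗ[ℂ] D) (hφ : ∀ m n, ‖φ m n‖ ≤ 4 * (‖e m‖ * ‖e n‖)) :
    E →ₗ⋆[ℂ] F →L[ℂ] D where
  toFun m := (φ m).extendOfNorm e
  map_add' m m' := ContinuousLinearMap.ext fun x => dense_ext he
    (f := (φ (m + m')).extendOfNorm e)
    (g := fun x => (φ m).extendOfNorm e x + (φ m').extendOfNorm e x)
    (by fun_prop) (by fun_prop) (fun n => by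
      rw [LinearMap.extendOfNorm_eq he (form_bound φ hφ _),
        LinearMap.extendOfNorm_eq he (form_bound φ hφ _),
        LinearMap.extendOfNorm_eq he (form_bound φ hφ _)]
      simp) x
  map_smul' c m := ContinuousLinearMap.ext fun x => dense_ext he
    (f := (φ (c • m)).extendOfNorm e)
    (g := fun x => (starRingEnd ℂ c) • (φ m).extendOfNorm e x)
    (by fun_prop) (by fun_prop) (fun n => by
      rw [LinearMap.extendOfNorm_eq he (form_bound φ hφ _),
        LinearMap.extendOfNorm_eq he (form_bound φ hφ _)]
      simp) x

theorem extendFormAux_bound (he : DenseRange e)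
    (φ : E →ₗ⋆[ℂ] E →ₗ[ℂ] D) (hφ : ∀ m n, ‖φ m n‖ ≤ 4 * (‖e m‖ * ‖e n‖)) (m : E) :
    ‖extendFormAux he φ hφ m‖ ≤ 4 * ‖e m‖ :=
  ContinuousLinearMap.opNorm_le_bound _ (by positivity) fun x =>
    LinearMap.norm_extendOfNorm_apply_le he _ (fun n => by rw [mul_assoc]; exact hφ m n) x

/-- Extension of a bounded sesquilinear form along a dense linear map `e`. -/
noncomputable def extendForm (he : DenseRange e)
    (φ : E →ₗ⋆[ℂ] E →ₗ[ℂ] D) (hφ : ∀ m n, ‖φ m n‖ ≤ 4 * (‖e m‖ * ‖e n‖)) :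
    F →L⋆[ℂ] F →L[ℂ] D :=
  (extendFormAux he φ hφ).extendOfNorm e

theorem extendForm_apply (he : DenseRange e)
    (φ : E →ₗ⋆[ℂ] E →ₗ[ℂ] D) (hφ : ∀ m n, ‖φ m n‖ ≤ 4 * (‖e m‖ * ‖e n‖)) (m n : E) :
    extendForm he φ hφ (e m) (e n) = φ m n := by
  unfold extendForm
  rw [LinearMap.extendOfNorm_eq he ⟨4, extendFormAux_bound he φ hφ⟩]
  exact LinearMap.extendOfNorm_eq he (form_bound φ hφ m) n

theorem continuous_of_bound₂ {E F G : Type*} [NormedAddCommGroup E] [NormedSpace ℂ E]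
    [NormedAddCommGroup F] [NormedSpace ℂ F] [NormedAddCommGroup G] [NormedSpace ℂ G]
    {σ : ℂ →+* ℂ} [RingHomIsometric σ] (f : E →ₛₗ[σ] F →ₗ[ℂ] G) (K : ℝ)
    (h : ∀ x y, ‖f x y‖ ≤ K * ‖x‖ * ‖y‖) : Continuous fun x : E × F => f x.1 x.2 := by
  have : Continuous fun x : E × F => f.mkContinuous₂ K h x.1 x.2 := by fun_prop
  exact this

end Extension

namespace PreHilbertBimodule

variable {A B E : Type*} [NonUnitalCStarAlgebra A] [NonUnitalCStarAlgebra B]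
    [AddCommGroup E] [Module ℂ E] (P : PreHilbertBimodule A B E)

/-- The extension of the module structure and of the inner products to the completion. -/
noncomputable def complForm (h : P.NullAssoc) : PreHilbertBimodule A B P.Compl :=
  have he := P.denseRange_toCompl
  let L : A →ₗ[ℂ] P.Compl →L[ℂ] P.Compl := extendAction he P.lsmul
    fun a => ⟨‖a‖, fun m => by simpa only [norm_toCompl] using P.rnorm_lsmul_le a m⟩
  let R : B →ₗ[ℂ] P.Compl →L[ℂ] P.Compl := extendAction he P.rsmul
    fun a => ⟨‖a‖, fun m => by simpa only [norm_toCompl] using P.rnorm_rsmul_le a m⟩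
  let Q : P.Compl →L⋆[ℂ] P.Compl →L[ℂ] B := extendForm he P.rinner
    fun m n => by simpa only [norm_toCompl] using P.norm_rinner_le m n
  let S : P.Compl →L⋆[ℂ] P.Compl →L[ℂ] A := extendForm he P.linner.flip
    fun m n => by
      simpa only [norm_toCompl, h.lnorm_eq, LinearMap.flip_apply, mul_comm (P.rnorm n)]
        using P.norm_linner_le n m
  have hL : ∀ a m, L a (P.toCompl m) = P.toCompl (P.lsmul a m) := extendAction_apply he _ _
  have hR : ∀ a m, R a (P.toCompl m) = P.toCompl (P.rsmul a m) := extendAction_apply he _ _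
  have hQ : ∀ m n, Q (P.toCompl m) (P.toCompl n) = P.rinner m n := extendForm_apply he _ _
  have hS : ∀ m n, S (P.toCompl m) (P.toCompl n) = P.linner n m := extendForm_apply he _ _
  { lsmul := LinearMap.mk₂ ℂ (fun a x => L a x) (by simp) (by simp) (by simp) (by simp)
    rsmul := LinearMap.mk₂ ℂ (fun a x => R a x) (by simp) (by simp) (by simp) (by simp)
    linner := LinearMap.mk₂'ₛₗ (RingHom.id ℂ) (starRingEnd ℂ) (fun x y => S y x)
      (by simp) (by simp) (by simp) (by simp)
    rinner := LinearMap.mk₂'ₛₗ (starRingEnd ℂ) (RingHom.id ℂ) (fun x y => Q x y)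
      (by simp) (by simp) (by simp) (by simp)
    mul_lsmul := fun a a' x => dense_ext he (f := fun x => L (a * a') x)
      (g := fun x => L a (L a' x)) (by fun_prop) (by fun_prop)
      (fun m => by simp only [hL, P.mul_lsmul]) x
    mul_rsmul := fun a a' x => dense_ext he (f := fun x => R (a * a') x)
      (g := fun x => R a' (R a x)) (by fun_prop) (by fun_prop)
      (fun m => by simp only [hR, P.mul_rsmul]) x
    lsmul_rsmul := fun a b x => dense_ext he (f := fun x => R b (L a x))
      (g := fun x => L a (R b x)) (by fun_prop) (by fun_prop)
      (fun m => by simp only [hR, hL, P.lsmul_rsmul]) x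
    linner_lsmul := fun a x y => dense_ext he (f := fun x => S y (L a x))
      (g := fun x => a * S y x) (by fun_prop) (by fun_prop)
      (fun m => dense_ext he (f := fun y => S y (L a (P.toCompl m)))
        (g := fun y => a * S y (P.toCompl m)) (by fun_prop) (by fun_prop)
        (fun n => by simp only [hL, hS, P.linner_lsmul]) y) x
    star_linner := fun x y => dense_ext he (f := fun x => star (S y x))
      (g := fun x => S x y) (by fun_prop) (by fun_prop)
      (fun m => dense_ext he (f := fun y => star (S y (P.toCompl m)))
        (g := fun y => S (P.toCompl m) y) (by fun_prop) (by fun_prop)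
        (fun n => by simp only [hS, P.star_linner]) y) x
    linner_self := fun x => he.induction_on (p := fun x => IsPos (S x x)) x
      (isClosed_isPos.preimage (f := fun x => S x x) (by fun_prop))
      (fun m => by simpa only [hS] using P.linner_self m)
    rinner_rsmul := fun a x y => dense_ext he (f := fun x => Q x (R a y))
      (g := fun x => Q x y * a) (by fun_prop) (by fun_prop)
      (fun m => dense_ext he (f := fun y => Q (P.toCompl m) (R a y))
        (g := fun y => Q (P.toCompl m) y * a) (by fun_prop) (by fun_prop)
        (fun n => by simp only [hR, hQ, P.rinner_rsmul]) y) x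
    star_rinner := fun x y => dense_ext he (f := fun x => star (Q x y))
      (g := fun x => Q y x) (by fun_prop) (by fun_prop)
      (fun m => dense_ext he (f := fun y => star (Q (P.toCompl m) y))
        (g := fun y => Q y (P.toCompl m)) (by fun_prop) (by fun_prop)
        (fun n => by simp only [hQ, P.star_rinner]) y) x
    rinner_self := fun x => he.induction_on (p := fun x => IsPos (Q x x)) x
      (isClosed_isPos.preimage (f := fun x => Q x x) (by fun_prop))
      (fun m => by simpa only [hQ] using P.rinner_self m)
    rinner_lsmul := fun a x y => dense_ext he (f := fun x => Q (L a x) y)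
      (g := fun x => Q x (L (star a) y)) (by fun_prop) (by fun_prop)
      (fun m => dense_ext he (f := fun y => Q (L a (P.toCompl m)) y)
        (g := fun y => Q (P.toCompl m) (L (star a) y)) (by fun_prop) (by fun_prop)
        (fun n => by simp only [hQ, hL, P.rinner_lsmul]) y) x
    linner_rsmul := fun a x y => dense_ext he (f := fun x => S y (R a x))
      (g := fun x => S (R (star a) y) x) (by fun_prop) (by fun_prop)
      (fun m => dense_ext he (f := fun y => S y (R a (P.toCompl m)))
        (g := fun y => S (R (star a) y) (P.toCompl m)) (by fun_prop) (by fun_prop)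
        (fun n => by simp only [hS, hR, P.linner_rsmul]) y) x }

variable {P} (h : P.NullAssoc)

theorem complForm_lsmul (a : A) (m : E) :
    (P.complForm h).lsmul a (P.toCompl m) = P.toCompl (P.lsmul a m) :=
  extendAction_apply P.denseRange_toCompl _ _ a m

theorem complForm_rsmul (b : B) (m : E) :
    (P.complForm h).rsmul b (P.toCompl m) = P.toCompl (P.rsmul b m) :=
  extendAction_apply P.denseRange_toCompl _ _ b m

theorem complForm_linner (m n : E) :
    (P.complForm h).linner (P.toCompl m) (P.toCompl n) = P.linner m n :=
  extendForm_apply P.denseRange_toCompl _ _ n m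

theorem complForm_rinner (m n : E) :
    (P.complForm h).rinner (P.toCompl m) (P.toCompl n) = P.rinner m n :=
  extendForm_apply P.denseRange_toCompl _ _ m n

end PreHilbertBimodule

namespace PreHilbertBimodule

variable {A B E : Type u} [NonUnitalCStarAlgebra A] [NonUnitalCStarAlgebra B]
    [AddCommGroup E] [Module ℂ E] {P : PreHilbertBimodule A B E}

theorem norm_complForm_rinner (h : P.NullAssoc) (x : P.Compl) :
    √‖(P.complForm h).rinner x x‖ = ‖x‖ := by
  have hc : Continuous fun x => (P.complForm h).rinner x x := by
    have : Continuous fun x => extendForm P.denseRange_toCompl P.rinner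
      (fun m n => by simpa only [norm_toCompl] using P.norm_rinner_le m n) x x := by fun_prop
    exact this
  refine dense_ext P.denseRange_toCompl (f := fun x => √‖(P.complForm h).rinner x x‖)
    (g := fun x => ‖x‖) (by fun_prop) (by fun_prop) (fun m => ?_) x
  rw [complForm_rinner, norm_toCompl]
  rfl

theorem norm_complForm_linner (h : P.NullAssoc) (x : P.Compl) :
    √‖(P.complForm h).linner x x‖ = ‖x‖ := by
  have hc : Continuous fun x => (P.complForm h).linner x x := by
    have : Continuous fun x => extendForm P.denseRange_toCompl P.linner.flip
      (fun m n => by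
        simpa only [norm_toCompl, h.lnorm_eq, LinearMap.flip_apply, mul_comm (P.rnorm n)]
        using P.norm_linner_le n m) x x := by fun_prop
    exact this
  refine dense_ext P.denseRange_toCompl (f := fun x => √‖(P.complForm h).linner x x‖)
    (g := fun x => ‖x‖) (by fun_prop) (by fun_prop) (fun m => ?_) x
  rw [complForm_linner, norm_toCompl, ← h.lnorm_eq]
  rfl

theorem toCompl_eq {m n : E} (h : ∀ w, P.rinner w m = P.rinner w n) :
    P.toCompl m = P.toCompl n := by
  rw [← sub_eq_zero, ← map_sub, ← norm_eq_zero, norm_toCompl]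
  have := P.rnorm_sq (m - n)
  rw [map_sub (P.rinner (m - n)), h, sub_self, norm_zero] at this
  exact pow_eq_zero_iff (two_ne_zero) |>.1 this

theorem continuous_complForm_rinner (h : P.NullAssoc) :
    Continuous fun x : P.Compl × P.Compl => (P.complForm h).rinner x.1 x.2 := by
  refine continuous_of_bound₂ (P.complForm h).rinner 4 fun x y => ?_
  have := (P.complForm h).norm_rinner_le x y
  simpa only [rnorm, gauge, norm_complForm_rinner, mul_assoc] using this

theorem continuous_complForm_linner (h : P.NullAssoc) :
    Continuous fun x : P.Compl × P.Compl => (P.complForm h).linner x.1 x.2 := by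
  refine (continuous_of_bound₂ (P.complForm h).linner.flip 4 fun x y => ?_).comp continuous_swap
  have := (P.complForm h).norm_linner_le y x
  simp only [lnorm, gauge, LinearMap.flip_apply, norm_complForm_linner] at this
  rw [LinearMap.flip_apply, mul_assoc, mul_comm ‖x‖]
  exact this

theorem continuous_complForm_lsmul (h : P.NullAssoc) :
    Continuous fun x : A × P.Compl => (P.complForm h).lsmul x.1 x.2 := by
  refine continuous_of_bound₂ (P.complForm h).lsmul 1 fun a x => ?_
  have := (P.complForm h).rnorm_lsmul_le a x
  simpa only [rnorm, gauge, norm_complForm_rinner, one_mul] using this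

theorem continuous_complForm_rsmul (h : P.NullAssoc) :
    Continuous fun x : B × P.Compl => (P.complForm h).rsmul x.1 x.2 := by
  refine continuous_of_bound₂ (P.complForm h).rsmul 1 fun a x => ?_
  have := (P.complForm h).rnorm_rsmul_le a x
  simpa only [rnorm, gauge, norm_complForm_rinner, one_mul] using this

theorem complForm_assoc (h : P.NullAssoc) (x y z : P.Compl) :
    (P.complForm h).lsmul ((P.complForm h).linner x y) z =
      (P.complForm h).rsmul ((P.complForm h).rinner y z) x := by
  have cl := continuous_complForm_lsmul h
  have cr := continuous_complForm_rsmul h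
  have cL := continuous_complForm_linner h
  have cR := continuous_complForm_rinner h
  have he := P.denseRange_toCompl
  have key : ∀ m n r, (P.complForm h).lsmul ((P.complForm h).linner (P.toCompl m) (P.toCompl n))
      (P.toCompl r) =
      (P.complForm h).rsmul ((P.complForm h).rinner (P.toCompl n) (P.toCompl r)) (P.toCompl m) := by
    intro m n r
    simp only [complForm_linner, complForm_rinner, complForm_lsmul, complForm_rsmul]
    exact toCompl_eq fun w => (h m n r w).1
  generalize P.complForm h = Q at *
  have h1 : Continuous fun p : P.Compl × P.Compl × P.Compl =>
      Q.lsmul (Q.linner p.1 p.2.1) p.2.2 :=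
    cl.comp ((cL.comp (continuous_fst.prodMk (continuous_fst.comp continuous_snd))).prodMk
      (continuous_snd.comp continuous_snd))
  have h2 : Continuous fun p : P.Compl × P.Compl × P.Compl =>
      Q.rsmul (Q.rinner p.2.1 p.2.2) p.1 :=
    cr.comp ((cR.comp continuous_snd).prodMk continuous_fst)
  exact (he.prodMap (he.prodMap he)).induction_on
    (p := fun p : P.Compl × P.Compl × P.Compl =>
      Q.lsmul (Q.linner p.1 p.2.1) p.2.2 = Q.rsmul (Q.rinner p.2.1 p.2.2) p.1) (x, y, z)
    (isClosed_eq h1 h2) (fun q => key _ _ _)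

/-- The associative Hilbert C*-bimodule obtained by completion. -/
noncomputable def complete (P : PreHilbertBimodule A B E) (h : P.NullAssoc)
    (hl : Dense (Submodule.span ℂ {x | ∃ a m, P.toCompl (P.lsmul a m) = x} : Set P.Compl))
    (hr : Dense (Submodule.span ℂ {x | ∃ b m, P.toCompl (P.rsmul b m) = x} : Set P.Compl)) :
    AssocHilbertBimodule A B where
  carrier := P.Compl
  form := P.complForm h
  linner_definite x hx := by
    rw [← norm_eq_zero, ← norm_complForm_linner h, hx]; simp
  rinner_definite x hx := by
    rw [← norm_eq_zero, ← norm_complForm_rinner h, hx]; simp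
  dense_lsmul := hl.mono (Submodule.span_mono (by
    rintro _ ⟨a, m, rfl⟩
    exact ⟨a, P.toCompl m, complForm_lsmul h a m⟩))
  dense_rsmul := hr.mono (Submodule.span_mono (by
    rintro _ ⟨a, m, rfl⟩
    exact ⟨a, P.toCompl m, complForm_rsmul h a m⟩))
  norm_equiv_left := ⟨1, 1, one_pos, fun m => by simp [norm_complForm_linner h]⟩
  norm_equiv_right := ⟨1, 1, one_pos, fun m => by simp [norm_complForm_rinner h]⟩
  assoc := complForm_assoc h

end PreHilbertBimodule

namespace AssocHilbertBimodule

open scoped TensorProduct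

variable {A B C : Type u} [NonUnitalCStarAlgebra A] [NonUnitalCStarAlgebra B]
  [NonUnitalCStarAlgebra C] (M : AssocHilbertBimodule A B) (N : AssocHilbertBimodule B C)

/-- The `C`-valued sesquilinear form on the algebraic tensor product determined by
`⟨m ⊗ n, m' ⊗ n'⟩_C = ⟨n, ⟨m, m'⟩_B n'⟩_C`. -/
noncomputable def tensorRinner :
    (M.carrier ⊗[ℂ] N.carrier) →ₗ⋆[ℂ] (M.carrier ⊗[ℂ] N.carrier) →ₗ[ℂ] C :=
  TensorProduct.lift (LinearMap.mk₂'ₛₗ (starRingEnd ℂ) (starRingEnd ℂ)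
    (fun m n => TensorProduct.lift (LinearMap.mk₂ ℂ
      (fun m' n' => N.form.rinner n (N.form.lsmul (M.form.rinner m m') n'))
      (by simp) (by simp) (by simp) (by simp)))
    (fun _ _ _ => TensorProduct.ext' (by simp)) (fun _ _ _ => TensorProduct.ext' (by simp))
    (fun _ _ _ => TensorProduct.ext' (by simp)) (fun _ _ _ => TensorProduct.ext' (by simp)))

theorem tensorRinner_tmul (m m' : M.carrier) (n n' : N.carrier) :
    M.tensorRinner N (m ⊗ₜ n) (m' ⊗ₜ n') =
      N.form.rinner n (N.form.lsmul (M.form.rinner m m') n') := by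
  rfl

/-- The `A`-valued sesquilinear form on the algebraic tensor product determined by
`_A⟨m ⊗ n, m' ⊗ n'⟩ = _A⟨m, m' _B⟨n', n⟩⟩`. -/
noncomputable def tensorLinner :
    (M.carrier ⊗[ℂ] N.carrier) →ₗ[ℂ] (M.carrier ⊗[ℂ] N.carrier) →ₗ⋆[ℂ] A :=
  TensorProduct.lift (LinearMap.mk₂ ℂ
    (fun m n => TensorProduct.lift (LinearMap.mk₂'ₛₗ (starRingEnd ℂ) (starRingEnd ℂ)
      (fun m' n' => M.form.linner m (M.form.rsmul (N.form.linner n' n) m'))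
      (by simp) (by simp) (by simp) (by simp)))
    (fun _ _ _ => TensorProduct.ext' (by simp)) (fun _ _ _ => TensorProduct.ext' (by simp))
    (fun _ _ _ => TensorProduct.ext' (by simp)) (fun _ _ _ => TensorProduct.ext' (by simp)))

theorem tensorLinner_tmul (m m' : M.carrier) (n n' : N.carrier) :
    M.tensorLinner N (m ⊗ₜ n) (m' ⊗ₜ n') =
      M.form.linner m (M.form.rsmul (N.form.linner n' n) m') := rfl

theorem exists_sum_tmul (t : M.carrier ⊗[ℂ] N.carrier) :
    ∃ (k : ℕ) (m : Fin k → M.carrier) (n : Fin k → N.carrier), t = ∑ i, m i ⊗ₜ[ℂ] n i := by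
  induction t using TensorProduct.induction_on with
  | zero => exact ⟨0, Fin.elim0, Fin.elim0, by simp⟩
  | tmul m n => exact ⟨1, fun _ => m, fun _ => n, by simp⟩
  | add s t hs ht =>
    obtain ⟨k, m, n, rfl⟩ := hs
    obtain ⟨l, m', n', rfl⟩ := ht
    exact ⟨k + l, Fin.append m m', Fin.append n n', by simp [Fin.sum_univ_add]⟩

theorem tensorRinner_self (t : M.carrier ⊗[ℂ] N.carrier) : IsPos (M.tensorRinner N t t) := by
  obtain ⟨k, m, n, rfl⟩ := M.exists_sum_tmul N t
  obtain ⟨d, hd⟩ := isPos_gram (fun i j => M.form.rinner (m i) (m j))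
    (fun i j => M.form.star_rinner _ _) (fun b => by
      convert! M.form.rinner_self (∑ i, M.form.rsmul (b i) (m i)) using 1
      simp only [map_sum, LinearMap.sum_apply, M.form.rinner_rsmul, M.form.rinner_rsmul_left,
        mul_assoc]
      rw [Finset.sum_comm])
  have : M.tensorRinner N (∑ i, m i ⊗ₜ[ℂ] n i) (∑ i, m i ⊗ₜ[ℂ] n i) =
      ∑ l, N.form.rinner (∑ i, N.form.lsmul (d l i) (n i)) (∑ i, N.form.lsmul (d l i) (n i)) := by
    simp only [map_sum, LinearMap.sum_apply, tensorRinner_tmul, hd, N.form.mul_lsmul,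
      N.form.rinner_lsmul]
    conv_rhs => rw [Finset.sum_comm]
    refine Finset.sum_congr rfl fun i _ => ?_
    exact Finset.sum_comm
  rw [this]
  exact IsPos.sum _ fun l _ => N.form.rinner_self _

theorem tensorLinner_self (t : M.carrier ⊗[ℂ] N.carrier) : IsPos (M.tensorLinner N t t) := by
  obtain ⟨k, m, n, rfl⟩ := M.exists_sum_tmul N t
  obtain ⟨d, hd⟩ := isPos_gram (fun i j => N.form.linner (n i) (n j))
    (fun i j => N.form.star_linner _ _) (fun b => by
      convert! N.form.linner_self (∑ i, N.form.lsmul (star (b i)) (n i)) using 1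
      simp only [map_sum, LinearMap.sum_apply, N.form.linner_lsmul, N.form.linner_lsmul_right,
        mul_assoc, star_star]
      rw [Finset.sum_comm])
  have : M.tensorLinner N (∑ i, m i ⊗ₜ[ℂ] n i) (∑ i, m i ⊗ₜ[ℂ] n i) =
      ∑ l, M.form.linner (∑ i, M.form.rsmul (star (d l i)) (m i))
        (∑ i, M.form.rsmul (star (d l i)) (m i)) := by
    simp only [map_sum, LinearMap.sum_apply, tensorLinner_tmul, hd, M.form.mul_rsmul,
      M.form.linner_rsmul, star_star]
    conv_rhs => rw [Finset.sum_comm]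
    refine Finset.sum_congr rfl fun i _ => ?_
    exact Finset.sum_comm
  rw [this]
  exact IsPos.sum _ fun l _ => M.form.linner_self _

theorem tensor_ext₂ {D : Type*} [AddCommGroup D] [Module ℂ D]
    {f g : (M.carrier ⊗[ℂ] N.carrier) → (M.carrier ⊗[ℂ] N.carrier) → D}
    (hf : ∀ s s' t, f (s + s') t = f s t + f s' t) (hf' : ∀ s t t', f s (t + t') = f s t + f s t')
    (hg : ∀ s s' t, g (s + s') t = g s t + g s' t) (hg' : ∀ s t t', g s (t + t') = g s t + g s t')
    (hf0 : ∀ t, f 0 t = 0) (hf0' : ∀ t, f t 0 = 0)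
    (hg0 : ∀ t, g 0 t = 0) (hg0' : ∀ t, g t 0 = 0)
    (h : ∀ m n m' n', f (m ⊗ₜ n) (m' ⊗ₜ n') = g (m ⊗ₜ n) (m' ⊗ₜ n')) (s t) : f s t = g s t := by
  induction s using TensorProduct.induction_on with
  | zero => rw [hf0, hg0]
  | add s s' hs hs' => rw [hf, hg, hs, hs']
  | tmul m n =>
    induction t using TensorProduct.induction_on with
    | zero => rw [hf0', hg0']
    | add s s' hs hs' => rw [hf', hg', hs, hs']
    | tmul x y => exact h m n x y

/-- The algebraic tensor product of two associative Hilbert C*-bimodules. -/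
noncomputable def preTensor : PreHilbertBimodule A C (M.carrier ⊗[ℂ] N.carrier) where
  lsmul := (LinearMap.rTensorHom N.carrier).comp M.form.lsmul
  rsmul := (LinearMap.lTensorHom M.carrier).comp N.form.rsmul
  linner := M.tensorLinner N
  rinner := M.tensorRinner N
  mul_lsmul a a' t := by
    induction t using TensorProduct.induction_on with
    | zero => simp
    | add s t hs ht => simp only [map_add, hs, ht]
    | tmul m n => simp [M.form.mul_lsmul]
  mul_rsmul a a' t := by
    induction t using TensorProduct.induction_on with
    | zero => simp
    | add s t hs ht => simp only [map_add, hs, ht]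
    | tmul m n => simp [N.form.mul_rsmul]
  lsmul_rsmul a a' t := by
    induction t using TensorProduct.induction_on with
    | zero => simp
    | add s t hs ht => simp only [map_add, hs, ht]
    | tmul m n => simp
  linner_lsmul a s t := by
    refine M.tensor_ext₂ N (f := fun s t => M.tensorLinner N (LinearMap.rTensorHom N.carrier (M.form.lsmul a) s) t)
      (g := fun s t => a * M.tensorLinner N s t) ?_ ?_ ?_ ?_ ?_ ?_ ?_ ?_ ?_ s t <;>
      simp [mul_add, tensorLinner_tmul, M.form.linner_lsmul]
  star_linner s t := by
    refine M.tensor_ext₂ N (f := fun s t => star (M.tensorLinner N s t))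
      (g := fun s t => M.tensorLinner N t s) ?_ ?_ ?_ ?_ ?_ ?_ ?_ ?_ ?_ s t <;>
      simp [tensorLinner_tmul, M.form.star_linner, M.form.linner_rsmul, N.form.star_linner]
  linner_self := M.tensorLinner_self N
  rinner_rsmul a s t := by
    refine M.tensor_ext₂ N (f := fun s t => M.tensorRinner N s (LinearMap.lTensorHom M.carrier (N.form.rsmul a) t))
      (g := fun s t => M.tensorRinner N s t * a) ?_ ?_ ?_ ?_ ?_ ?_ ?_ ?_ ?_ s t <;>
      simp [add_mul, tensorRinner_tmul, ← N.form.lsmul_rsmul, N.form.rinner_rsmul]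
  star_rinner s t := by
    refine M.tensor_ext₂ N (f := fun s t => star (M.tensorRinner N s t))
      (g := fun s t => M.tensorRinner N t s) ?_ ?_ ?_ ?_ ?_ ?_ ?_ ?_ ?_ s t <;>
      simp [tensorRinner_tmul, N.form.star_rinner, N.form.rinner_lsmul, M.form.star_rinner]
  rinner_self := M.tensorRinner_self N
  rinner_lsmul a s t := by
    refine M.tensor_ext₂ N (f := fun s t => M.tensorRinner N (LinearMap.rTensorHom N.carrier (M.form.lsmul a) s) t)
      (g := fun s t => M.tensorRinner N s (LinearMap.rTensorHom N.carrier (M.form.lsmul (star a)) t)) ?_ ?_ ?_ ?_ ?_ ?_ ?_ ?_ ?_ s t <;>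
      simp [tensorRinner_tmul, M.form.rinner_lsmul]
  linner_rsmul a s t := by
    refine M.tensor_ext₂ N (f := fun s t => M.tensorLinner N (LinearMap.lTensorHom M.carrier (N.form.rsmul a) s) t)
      (g := fun s t => M.tensorLinner N s (LinearMap.lTensorHom M.carrier (N.form.rsmul (star a)) t)) ?_ ?_ ?_ ?_ ?_ ?_ ?_ ?_ ?_ s t <;>
      simp [tensorLinner_tmul, N.form.linner_rsmul]

theorem preTensor_lsmul (a : A) (m : M.carrier) (n : N.carrier) :
    (M.preTensor N).lsmul a (m ⊗ₜ n) = (M.form.lsmul a m) ⊗ₜ n := rfl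

theorem preTensor_rsmul (c : C) (m : M.carrier) (n : N.carrier) :
    (M.preTensor N).rsmul c (m ⊗ₜ n) = m ⊗ₜ (N.form.rsmul c n) := rfl

theorem preTensor_rinner_balanced (w : M.carrier ⊗[ℂ] N.carrier) (b : B) (m : M.carrier)
    (n : N.carrier) : (M.preTensor N).rinner w (M.form.rsmul b m ⊗ₜ n) =
      (M.preTensor N).rinner w (m ⊗ₜ N.form.lsmul b n) := by
  induction w using TensorProduct.induction_on with
  | zero => simp
  | add s t hs ht => simp only [map_add, LinearMap.add_apply, hs, ht]
  | tmul m' n' =>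
    change M.tensorRinner N _ _ = M.tensorRinner N _ _
    rw [tensorRinner_tmul, tensorRinner_tmul, M.form.rinner_rsmul, N.form.mul_lsmul]

theorem preTensor_linner_balanced (w : M.carrier ⊗[ℂ] N.carrier) (b : B) (m : M.carrier)
    (n : N.carrier) : (M.preTensor N).linner w (M.form.rsmul b m ⊗ₜ n) =
      (M.preTensor N).linner w (m ⊗ₜ N.form.lsmul b n) := by
  induction w using TensorProduct.induction_on with
  | zero => simp
  | add s t hs ht => simp only [map_add, LinearMap.add_apply, hs, ht]
  | tmul m' n' =>
    change M.tensorLinner N _ _ = M.tensorLinner N _ _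
    rw [tensorLinner_tmul, tensorLinner_tmul, N.form.linner_lsmul, M.form.mul_rsmul]

theorem preTensor_nullAssoc : (M.preTensor N).NullAssoc := by
  have key : ∀ (x y z : M.carrier ⊗[ℂ] N.carrier) {D : Type u} [AddCommGroup D] [Module ℂ D]
      (F : (M.carrier ⊗[ℂ] N.carrier) →+ D)
      (hF : ∀ b m n, F (M.form.rsmul b m ⊗ₜ n) = F (m ⊗ₜ N.form.lsmul b n)),
      F ((M.preTensor N).lsmul ((M.preTensor N).linner x y) z) =
        F ((M.preTensor N).rsmul ((M.preTensor N).rinner y z) x) := by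
    intro x y z D _ _ F hF
    induction x using TensorProduct.induction_on with
    | zero => simp
    | add s t hs ht => simp only [map_add, LinearMap.add_apply, hs, ht]
    | tmul m n =>
    induction y using TensorProduct.induction_on with
    | zero => simp
    | add s t hs ht => simp only [map_add, LinearMap.add_apply, hs, ht]
    | tmul m' n' =>
    induction z using TensorProduct.induction_on with
    | zero => simp
    | add s t hs ht => simp only [map_add, LinearMap.add_apply, hs, ht]
    | tmul m'' n'' =>
    rw [preTensor_lsmul, preTensor_rsmul]
    change F (M.form.lsmul (M.tensorLinner N _ _) _ ⊗ₜ _) =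
      F (_ ⊗ₜ N.form.rsmul (M.tensorRinner N _ _) _)
    rw [tensorLinner_tmul, tensorRinner_tmul, M.assoc, M.form.rinner_rsmul_left, hF,
      N.form.star_linner, N.form.mul_lsmul, N.assoc]
  intro x y z w
  exact ⟨key x y z ((M.preTensor N).rinner w).toAddMonoidHom (M.preTensor_rinner_balanced N w),
    key x y z ((M.preTensor N).linner w).toAddMonoidHom (M.preTensor_linner_balanced N w)⟩

theorem preTensor_dense {s : Set (M.preTensor N).Compl}
    (h : ∀ m n, (M.preTensor N).toCompl (m ⊗ₜ n) ∈ closure (Submodule.span ℂ s : Set _)) :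
    Dense (Submodule.span ℂ s : Set (M.preTensor N).Compl) := by
  have h1 : ∀ t, (M.preTensor N).toCompl t ∈ (Submodule.span ℂ s).topologicalClosure := by
    intro t
    induction t using TensorProduct.induction_on with
    | zero => simp
    | add s t hs ht => rw [map_add]; exact add_mem hs ht
    | tmul m n => exact h m n
  intro x
  exact closure_minimal (s := Set.range (M.preTensor N).toCompl) (by rintro _ ⟨t, rfl⟩; exact h1 t)
    isClosed_closure ((M.preTensor N).denseRange_toCompl x)

theorem preTensor_rnorm_le (m : M.carrier) (n : N.carrier) :
    (M.preTensor N).rnorm (m ⊗ₜ n) ≤ 2 * (M.form.rnorm m * N.form.rnorm n) := by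
  have hm := M.form.rnorm_nonneg m
  have hn := N.form.rnorm_nonneg n
  refine (abs_le_of_sq_le_sq' ?_ (by positivity)).2
  have h1 : ‖(M.preTensor N).rinner (m ⊗ₜ n) (m ⊗ₜ n)‖ ≤
      4 * (N.form.rnorm n * (‖M.form.rinner m m‖ * N.form.rnorm n)) := by
    refine (N.form.norm_rinner_le n (N.form.lsmul (M.form.rinner m m) n)).trans ?_
    gcongr
    exact N.form.rnorm_lsmul_le _ _
  rw [(M.preTensor N).rnorm_sq]
  refine h1.trans (le_of_eq ?_)
  rw [← M.form.rnorm_sq]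
  ring

theorem exists_rnorm_le : ∃ K : ℝ, ∀ m : M.carrier, M.form.rnorm m ≤ K * ‖m‖ := by
  obtain ⟨c, K, _, h⟩ := M.norm_equiv_right
  exact ⟨K, fun m => (h m).2⟩

theorem mem_of_dense {E F : Type*} [NormedAddCommGroup E] [NormedSpace ℂ E]
    [NormedAddCommGroup F] [NormedSpace ℂ F] (f : E →ₗ[ℂ] F) (K : ℝ) (hK : ∀ x, ‖f x‖ ≤ K * ‖x‖)
    {s : Set E} (hs : Dense (Submodule.span ℂ s : Set E)) (W : Submodule ℂ F)
    (h : ∀ x ∈ s, f x ∈ W) (x : E) : f x ∈ closure (W : Set F) := by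
  have hf : Continuous f := (f.mkContinuous K hK).continuous
  have h1 : Submodule.span ℂ s ≤ W.comap f := Submodule.span_le.2 h
  refine map_mem_closure hf (hs x) fun y hy => h1 hy

theorem preTensor_dense_lsmul : Dense (Submodule.span ℂ {x | ∃ a t,
    (M.preTensor N).toCompl ((M.preTensor N).lsmul a t) = x} : Set (M.preTensor N).Compl) := by
  refine M.preTensor_dense N fun m n => ?_
  obtain ⟨K, hK⟩ := M.exists_rnorm_le
  refine mem_of_dense ((M.preTensor N).toCompl.comp ((TensorProduct.mk ℂ M.carrier N.carrier).flip n))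
    (2 * (K * N.form.rnorm n)) (fun m => ?_) M.dense_lsmul _ ?_ m
  · simp only [LinearMap.comp_apply, LinearMap.flip_apply, TensorProduct.mk_apply,
      PreHilbertBimodule.norm_toCompl]
    refine (M.preTensor_rnorm_le N m n).trans ?_
    have := mul_le_mul_of_nonneg_right (hK m) (N.form.rnorm_nonneg n)
    linarith
  · rintro _ ⟨a, m, rfl⟩
    exact Submodule.subset_span ⟨a, m ⊗ₜ n, rfl⟩

theorem preTensor_dense_rsmul : Dense (Submodule.span ℂ {x | ∃ c t,
    (M.preTensor N).toCompl ((M.preTensor N).rsmul c t) = x} : Set (M.preTensor N).Compl) := by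
  refine M.preTensor_dense N fun m n => ?_
  obtain ⟨K, hK⟩ := N.exists_rnorm_le
  refine mem_of_dense ((M.preTensor N).toCompl.comp (TensorProduct.mk ℂ M.carrier N.carrier m))
    (2 * (M.form.rnorm m * K)) (fun n => ?_) N.dense_rsmul _ ?_ n
  · simp only [LinearMap.comp_apply, TensorProduct.mk_apply, PreHilbertBimodule.norm_toCompl]
    refine (M.preTensor_rnorm_le N m n).trans ?_
    have := mul_le_mul_of_nonneg_left (hK n) (M.form.rnorm_nonneg m)
    linarith
  · rintro _ ⟨a, n, rfl⟩
    exact Submodule.subset_span ⟨a, m ⊗ₜ n, rfl⟩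

/-- The tensor product `M ⊗_B N`: the Hausdorff completion of the algebraic tensor product with
respect to the above inner products.  The vectors `m b ⊗ n - m ⊗ b n` are null vectors. -/
noncomputable def tensor : AssocHilbertBimodule A C :=
  (M.preTensor N).complete (M.preTensor_nullAssoc N) (M.preTensor_dense_lsmul N)
    (M.preTensor_dense_rsmul N)

end AssocHilbertBimodule

namespace AssocHilbertBimodule

open scoped TensorProduct

variable {A B C : Type u} [NonUnitalCStarAlgebra A] [NonUnitalCStarAlgebra B]
  [NonUnitalCStarAlgebra C]

theorem continuous_rinner (M : AssocHilbertBimodule A B) :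
    Continuous fun x : M.carrier × M.carrier => M.form.rinner x.1 x.2 := by
  obtain ⟨K, hK⟩ := M.exists_rnorm_le
  refine continuous_of_bound₂ M.form.rinner (4 * (K * K)) fun x y => ?_
  refine (M.form.norm_rinner_le x y).trans ?_
  have := mul_le_mul (hK x) (hK y) (M.form.rnorm_nonneg y) ((M.form.rnorm_nonneg x).trans (hK x))
  linarith

theorem continuous_linner (M : AssocHilbertBimodule A B) :
    Continuous fun x : M.carrier × M.carrier => M.form.linner x.1 x.2 := by
  obtain ⟨_, K, _, h⟩ := M.norm_equiv_left
  have hK : ∀ m, M.form.lnorm m ≤ K * ‖m‖ := fun m => (h m).2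
  refine (continuous_of_bound₂ M.form.linner.flip (4 * (K * K)) fun x y => ?_).comp continuous_swap
  refine (M.form.norm_linner_le y x).trans ?_
  have := mul_le_mul (hK y) (hK x) (M.form.lnorm_nonneg x) ((M.form.lnorm_nonneg y).trans (hK y))
  linarith

theorem continuous_of_rnorm {M N : AssocHilbertBimodule A B} (f : M.carrier →ₗ[ℂ] N.carrier)
    (C : ℝ) (hC : 0 ≤ C) (hf : ∀ m, N.form.rnorm (f m) ≤ C * M.form.rnorm m) : Continuous f := by
  obtain ⟨K, hK⟩ := M.exists_rnorm_le
  obtain ⟨c, _, hc, h⟩ := N.norm_equiv_right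
  refine (f.mkContinuous (c⁻¹ * (C * K)) fun m => ?_).continuous
  rw [mul_assoc, inv_mul_eq_div, le_div_iff₀ hc, mul_comm, mul_assoc]
  exact (h _).1.trans ((hf m).trans (mul_le_mul_of_nonneg_left (hK m) hC))

theorem continuous_lsmul (M : AssocHilbertBimodule A B) (a : A) : Continuous (M.form.lsmul a) :=
  continuous_of_rnorm _ ‖a‖ (norm_nonneg _) (M.form.rnorm_lsmul_le a)

theorem continuous_rsmul (M : AssocHilbertBimodule A B) (b : B) : Continuous (M.form.rsmul b) :=
  continuous_of_rnorm _ ‖b‖ (norm_nonneg _) (M.form.rnorm_rsmul_le b)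

theorem norm_le_of_rnorm_eq (M N : AssocHilbertBimodule A B) : ∃ K : ℝ, ∀ m n,
    M.form.rinner m m = N.form.rinner n n → ‖m‖ ≤ K * ‖n‖ := by
  obtain ⟨K, hK⟩ := N.exists_rnorm_le
  obtain ⟨c, _, hc, h⟩ := M.norm_equiv_right
  refine ⟨c⁻¹ * K, fun m n e => ?_⟩
  rw [mul_assoc, inv_mul_eq_div, le_div_iff₀ hc, mul_comm]
  refine (h m).1.trans ?_
  rw [e]
  exact hK n

/-- Two associative Hilbert C*-bimodules with dense maps from the same space that induce the same
operations are isomorphic. -/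
theorem nonempty_iso_of_dense {E : Type*} [AddCommGroup E] [Module ℂ E]
    {M N : AssocHilbertBimodule A B} (P : PreHilbertBimodule A B E)
    {e : E →ₗ[ℂ] M.carrier} {f : E →ₗ[ℂ] N.carrier} (he : DenseRange e) (hf : DenseRange f)
    (hel : ∀ a x, M.form.lsmul a (e x) = e (P.lsmul a x))
    (hfl : ∀ a x, N.form.lsmul a (f x) = f (P.lsmul a x))
    (her : ∀ a x, M.form.rsmul a (e x) = e (P.rsmul a x))
    (hfr : ∀ a x, N.form.rsmul a (f x) = f (P.rsmul a x))
    (heL : ∀ x y, M.form.linner (e x) (e y) = P.linner x y)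
    (hfL : ∀ x y, N.form.linner (f x) (f y) = P.linner x y)
    (heR : ∀ x y, M.form.rinner (e x) (e y) = P.rinner x y)
    (hfR : ∀ x y, N.form.rinner (f x) (f y) = P.rinner x y) : Nonempty (Iso M N) := by
  have h1 : ∃ K, ∀ x, ‖f x‖ ≤ K * ‖e x‖ := by
    obtain ⟨K, hK⟩ := N.norm_le_of_rnorm_eq M
    exact ⟨K, fun x => hK _ _ (by rw [heR, hfR])⟩
  have h2 : ∃ K, ∀ x, ‖e x‖ ≤ K * ‖f x‖ := by
    obtain ⟨K, hK⟩ := M.norm_le_of_rnorm_eq N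
    exact ⟨K, fun x => hK _ _ (by rw [heR, hfR])⟩
  let T : M.carrier ≃L[ℂ] N.carrier := (LinearEquiv.refl ℂ E).extend e f he h1 hf h2
  have hT : ∀ x, T (e x) = f x := LinearMap.extendOfNorm_eq he h1
  have cL := N.continuous_linner
  have cR := N.continuous_rinner
  have cL' := M.continuous_linner
  have cR' := M.continuous_rinner
  have cl := N.continuous_lsmul
  have cr := N.continuous_rsmul
  have cl' := M.continuous_lsmul
  have cr' := M.continuous_rsmul
  refine ⟨⟨T.toLinearEquiv, fun a m => ?_, fun a m => ?_, fun m n => ?_, fun m n => ?_⟩⟩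
  · exact dense_ext he (f := fun m => T (M.form.lsmul a m)) (g := fun m => N.form.lsmul a (T m))
      (by fun_prop) (by fun_prop) (fun x => by simp only [hel, hfl, hT]) m
  · exact dense_ext he (f := fun m => T (M.form.rsmul a m)) (g := fun m => N.form.rsmul a (T m))
      (by fun_prop) (by fun_prop) (fun x => by simp only [her, hfr, hT]) m
  · exact (he.prodMap he).induction_on
      (p := fun p => N.form.linner (T p.1) (T p.2) = M.form.linner p.1 p.2) (m, n)
      (isClosed_eq (by fun_prop) (by fun_prop)) (fun x => by simp [hT, heL, hfL])
  · exact (he.prodMap he).induction_on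
      (p := fun p => N.form.rinner (T p.1) (T p.2) = M.form.rinner p.1 p.2) (m, n)
      (isClosed_eq (by fun_prop) (by fun_prop)) (fun x => by simp [hT, heR, hfR])

theorem tensor_congr {M M' : AssocHilbertBimodule A B} {N N' : AssocHilbertBimodule B C}
    (f : Iso M M') (g : Iso N N') : Nonempty (Iso (M.tensor N) (M'.tensor N')) := by
  have hn := M.preTensor_nullAssoc N
  have hn' := M'.preTensor_nullAssoc N'
  let u := TensorProduct.congr f.toEquiv g.toEquiv
  have hu : DenseRange ((M'.preTensor N').toCompl.comp u.toLinearMap) := by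
    have := (M'.preTensor N').denseRange_toCompl
    rw [DenseRange, ← u.surjective.range_comp] at this
    exact this
  refine nonempty_iso_of_dense (M := M.tensor N) (N := M'.tensor N') (M.preTensor N)
    (e := (M.preTensor N).toCompl)
    (f := (M'.preTensor N').toCompl.comp u.toLinearMap) (M.preTensor N).denseRange_toCompl hu
    (PreHilbertBimodule.complForm_lsmul hn) (fun a x => ?_)
    (PreHilbertBimodule.complForm_rsmul hn) (fun a x => ?_)
    (PreHilbertBimodule.complForm_linner hn) (fun x y => ?_)
    (PreHilbertBimodule.complForm_rinner hn) (fun x y => ?_)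
  · refine (PreHilbertBimodule.complForm_lsmul hn' a (u x)).trans (congrArg _ ?_)
    induction x using TensorProduct.induction_on with
    | zero => simp
    | add s t hs ht => simp only [map_add, hs, ht]
    | tmul m n => simp [u, preTensor_lsmul, f.map_lsmul]
  · refine (PreHilbertBimodule.complForm_rsmul hn' a (u x)).trans (congrArg _ ?_)
    induction x using TensorProduct.induction_on with
    | zero => simp
    | add s t hs ht => simp only [map_add, hs, ht]
    | tmul m n => simp [u, preTensor_rsmul, g.map_rsmul]
  · refine (PreHilbertBimodule.complForm_linner hn' (u x) (u y)).trans ?_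
    refine M.tensor_ext₂ N (f := fun x y => M'.tensorLinner N' (u x) (u y))
      (g := fun x y => M.tensorLinner N x y) ?_ ?_ ?_ ?_ ?_ ?_ ?_ ?_ ?_ x y <;>
      simp [tensorLinner_tmul, u, g.linner_map, ← f.map_rsmul, f.linner_map]
  · refine (PreHilbertBimodule.complForm_rinner hn' (u x) (u y)).trans ?_
    refine M.tensor_ext₂ N (f := fun x y => M'.tensorRinner N' (u x) (u y))
      (g := fun x y => M.tensorRinner N x y) ?_ ?_ ?_ ?_ ?_ ?_ ?_ ?_ ?_ x y <;>
      simp [tensorRinner_tmul, u, f.rinner_map, ← g.map_lsmul, g.rinner_map]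

/-- Isomorphism as an equivalence relation. -/
instance isoSetoid (A B : Type u) [NonUnitalCStarAlgebra A] [NonUnitalCStarAlgebra B] :
    Setoid (AssocHilbertBimodule A B) where
  r M N := Nonempty (Iso M N)
  iseqv := ⟨fun M => ⟨Iso.refl M⟩, fun ⟨f⟩ => ⟨f.symm⟩, fun ⟨f⟩ ⟨g⟩ => ⟨f.trans g⟩⟩

end AssocHilbertBimodule

/-- `S(A)`: the isomorphism classes of associative Hilbert C*-bimodules over `A`. -/
def BimoduleSemigroup (A : Type u) [NonUnitalCStarAlgebra A] : Type (u + 1) :=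
  Quotient (AssocHilbertBimodule.isoSetoid A A)

/-- The product of `S(A)`, induced by the tensor product over `A`. -/
noncomputable instance (A : Type u) [NonUnitalCStarAlgebra A] : Mul (BimoduleSemigroup A) where
  mul := Quotient.map₂ (fun M N => M.tensor N)
    (fun _ _ ⟨f⟩ _ _ ⟨g⟩ => AssocHilbertBimodule.tensor_congr f g)

/-- The partial bijections of a set `X`. -/
def PartialBijection (X : Type*) : Type _ := X ≃. X

/-- Composition of partial bijections, `(f * g) x = f (g x)` where this is defined. -/
instance (X : Type*) : Mul (PartialBijection X) where
  mul f g := PEquiv.trans g f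

end CStarBimod

/-! Let `e_i` be the minimal projections of `ℂ ^ ι`. Non-degeneracy forces the unit `∑ e_i` to act
as the identity, so a bimodule `M` is the finite direct sum of its corners `e_i M e_j`. On such a
corner both actions are scalar, and the two inner products take values in `ℂ e_i` and `ℂ e_j`.

Associativity of the two inner products then makes `M` rigid. Two non-zero corners cannot share a
row or a column (`corner_left_unique`, `corner_right_unique`). A non-zero corner is a line
(`exists_eq_smul_of_mem_corner`), and on it the two squared lengths of a vector are the same scalar,
so one rescaling normalizes both (`exists_unit_of_mem_corner`). Hence the pairs `(i, j)` with `e_i M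
e_j ≠ 0` form the graph of a partial bijection `j ↦ i`, the support of `M`. Choosing a unit vector
in every non-zero corner identifies `M` with the functions on this graph (`nonempty_iso_model`), so
the support is a complete invariant. Functions on the graph of an arbitrary partial bijection
realize it as a support (`support_model`).

For products, inserting `∑ e_j` in the middle of `e_i (M ⊗ N) e_k` shows that this corner is
non-zero exactly when `e_i M e_j` and `e_j N e_k` are both non-zero for some `j`. This is
composition of the supports (`support_tensor`). -/

namespace CStarBimod

/-! ### Partial bijections described by their graphs. -/

open Classical in
/-- The partial bijection whose graph is a given relation. -/
noncomputable def PartialBijection.ofRel {X : Type*} (r : X → X → Prop)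
    (hl : ∀ i i' j, r i j → r i' j → i = i') (hr : ∀ i j j', r i j → r i j' → j = j') :
    PartialBijection X where
  -- A pair `r i j` is an arrow from `j` to `i`, like a matrix unit, so that products of corners
  -- will match composition with the right factor applied first. Uniqueness of `i` given `j` is
  -- `hl`; the inverse direction rests on `hr`.
  toFun j := if h : ∃ i, r i j then some h.choose else none
  invFun i := if h : ∃ j, r i j then some h.choose else none
  inv j i := by
    have h1 : (j ∈ if h : ∃ j, r i j then some h.choose else none) ↔ r i j := by
      split_ifs with h
      · rw [Option.mem_some_iff]
        exact ⟨fun e => e ▸ h.choose_spec, fun e => hr _ _ _ h.choose_spec e⟩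
      · simpa using fun e => h ⟨j, e⟩
    have h2 : (i ∈ if h : ∃ i, r i j then some h.choose else none) ↔ r i j := by
      split_ifs with h
      · rw [Option.mem_some_iff]
        exact ⟨fun e => e ▸ h.choose_spec, fun e => hl _ _ _ h.choose_spec e⟩
      · simpa using fun e => h ⟨i, e⟩
    exact h1.trans h2.symm

theorem PartialBijection.mem_ofRel {X : Type*} {r : X → X → Prop}
    (hl : ∀ i i' j, r i j → r i' j → i = i') (hr : ∀ i j j', r i j → r i j' → j = j') {i j : X} :
    PEquiv.toFun (PartialBijection.ofRel r hl hr) j = some i ↔ r i j := by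
  unfold PartialBijection.ofRel
  dsimp only
  split_ifs with h
  · rw [Option.some_inj]
    exact ⟨fun e => e ▸ h.choose_spec, fun e => hl _ _ _ h.choose_spec e⟩
  · simpa using fun e => h ⟨i, e⟩

theorem PartialBijection.ext {X : Type*} {f g : PartialBijection X}
    (h : ∀ i j, PEquiv.toFun f j = some i ↔ PEquiv.toFun g j = some i) : f = g :=
  PEquiv.ext fun j => Option.ext fun i => h i j

theorem PartialBijection.mul_eq_some {X : Type*} {f g : PartialBijection X} {i k : X} :
    PEquiv.toFun (f * g) k = some i ↔
      ∃ j, PEquiv.toFun f j = some i ∧ PEquiv.toFun g k = some j :=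
  (PEquiv.mem_trans g f k i).trans (by simp only [and_comm]; rfl)

theorem PartialBijection.injective_of_eq_some {X : Type*} {f : PartialBijection X} {i j j' : X}
    (h : PEquiv.toFun f j = some i) (h' : PEquiv.toFun f j' = some i) : j = j' :=
  PEquiv.inj f h h'

theorem PartialBijection.injective_fst_graph {X : Type*} (f : PartialBijection X) :
    Function.Injective fun p : {p : X × X // PEquiv.toFun f p.2 = some p.1} => p.1.1 := by
  rintro ⟨⟨i, j⟩, h⟩ ⟨⟨i', j'⟩, h'⟩ (rfl : i = i')
  obtain rfl := PartialBijection.injective_of_eq_some h h'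
  rfl

theorem PartialBijection.injective_snd_graph {X : Type*} (f : PartialBijection X) :
    Function.Injective fun p : {p : X × X // PEquiv.toFun f p.2 = some p.1} => p.1.2 := by
  rintro ⟨⟨i, j⟩, h⟩ ⟨⟨i', j'⟩, h'⟩ (rfl : j = j')
  obtain rfl := Option.some_inj.1 (h.symm.trans h')
  rfl

/-- Presents a partial bijection as a pair of injections from its graph. Together with the two
injectivity lemmas above, this is the input format of the model bimodules. -/
theorem PartialBijection.eq_some_iff_exists_graph {X : Type*} (f : PartialBijection X) (i j : X) :
    PEquiv.toFun f j = some i ↔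
      ∃ t : {p : X × X // PEquiv.toFun f p.2 = some p.1}, t.1.1 = i ∧ t.1.2 = j :=
  ⟨fun h => ⟨⟨(i, j), h⟩, rfl, rfl⟩, by rintro ⟨t, rfl, rfl⟩; exact t.2⟩

namespace AssocHilbertBimodule

open scoped TensorProduct

variable {ι : Type}

/-! ### Corners of a bimodule and the support. -/

section Corner

variable [Fintype ι] (M : AssocHilbertBimodule (ι → ℂ) (ι → ℂ))

/-- The actions are only assumed multiplicative, so unitality has to come from non-degeneracy: `1`
fixes every vector `a m`, these span a dense subspace, and the action of `1` is continuous. -/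
theorem one_lsmul (m : M.carrier) : M.form.lsmul 1 m = m := by
  refine congrFun (Continuous.ext_on M.dense_lsmul (M.continuous_lsmul 1) continuous_id
    fun x hx => ?_) m
  have h : Submodule.span ℂ {x | ∃ a m, M.form.lsmul a m = x} ≤
      LinearMap.eqLocus (M.form.lsmul 1) LinearMap.id := by
    rw [Submodule.span_le]
    rintro _ ⟨a, m, rfl⟩
    simp [← M.form.mul_lsmul]
  exact h hx

theorem one_rsmul (m : M.carrier) : M.form.rsmul 1 m = m := by
  refine congrFun (Continuous.ext_on M.dense_rsmul (M.continuous_rsmul 1) continuous_id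
    fun x hx => ?_) m
  have h : Submodule.span ℂ {x | ∃ a m, M.form.rsmul a m = x} ≤
      LinearMap.eqLocus (M.form.rsmul 1) LinearMap.id := by
    rw [Submodule.span_le]
    rintro _ ⟨a, m, rfl⟩
    simp [← M.form.mul_rsmul]
  exact h hx

variable [DecidableEq ι]

/-- The corner `e_i M e_j` of a bimodule over `ℂ ^ ι`. -/
noncomputable def corner (i j : ι) : Submodule ℂ M.carrier :=
  LinearMap.eqLocus (M.form.lsmul (Pi.single i 1)) LinearMap.id ⊓
    LinearMap.eqLocus (M.form.rsmul (Pi.single j 1)) LinearMap.id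

variable {M}

theorem mem_corner {i j : ι} {m : M.carrier} : m ∈ M.corner i j ↔
    M.form.lsmul (Pi.single i 1) m = m ∧ M.form.rsmul (Pi.single j 1) m = m := Iff.rfl

variable (M) in
theorem compress_mem_corner (i j : ι) (m : M.carrier) :
    M.form.rsmul (Pi.single j 1) (M.form.lsmul (Pi.single i 1) m) ∈ M.corner i j := by
  rw [mem_corner, ← M.form.lsmul_rsmul, ← M.form.mul_lsmul, ← M.form.mul_rsmul]
  simp [← Pi.single_mul]

variable (M) in
-- The Peirce decomposition with respect to `1 = ∑ e_i` on both sides.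
theorem sum_compress (m : M.carrier) : ∑ i : ι, ∑ j : ι,
    M.form.rsmul (Pi.single j 1) (M.form.lsmul (Pi.single i 1) m) = m := by
  have h : ∑ i : ι, (Pi.single i 1 : ι → ℂ) = 1 := Finset.univ_sum_single 1
  simp_rw [← LinearMap.sum_apply, ← map_sum, h, one_rsmul]
  rw [← LinearMap.sum_apply, ← map_sum, h, one_lsmul]

theorem lsmul_of_mem_corner {i j : ι} {m : M.carrier} (hm : m ∈ M.corner i j) (a : ι → ℂ) :
    M.form.lsmul a m = a i • m := by
  have h : a * Pi.single i 1 = a i • (Pi.single i 1 : ι → ℂ) := by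
    ext k
    by_cases hk : k = i
    · subst hk; simp
    · simp [hk]
  rw [← (mem_corner.1 hm).1, ← M.form.mul_lsmul, h, map_smul, LinearMap.smul_apply]

theorem rsmul_of_mem_corner {i j : ι} {m : M.carrier} (hm : m ∈ M.corner i j) (b : ι → ℂ) :
    M.form.rsmul b m = b j • m := by
  have h : Pi.single j 1 * b = b j • (Pi.single j 1 : ι → ℂ) := by
    ext k
    by_cases hk : k = j
    · subst hk; simp
    · simp [hk]
  rw [← (mem_corner.1 hm).2, ← M.form.mul_rsmul, h, map_smul, LinearMap.smul_apply]

/-- Since `m = e_i m`, the factor `e_i` can be pulled out of the inner product. The other vector is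
arbitrary, which lets the orthogonality lemma below apply this to both arguments. -/
theorem linner_eq_single {i j : ι} {m : M.carrier} (hm : m ∈ M.corner i j) (n : M.carrier) :
    M.form.linner m n = Pi.single i (M.form.linner m n i) := by
  ext k
  conv_lhs => rw [← (mem_corner.1 hm).1, M.form.linner_lsmul]
  by_cases hk : k = i
  · subst hk; simp
  · simp [hk]

theorem rinner_eq_single {i j : ι} {n : M.carrier} (hn : n ∈ M.corner i j) (m : M.carrier) :
    M.form.rinner m n = Pi.single j (M.form.rinner m n j) := by
  ext k
  conv_lhs => rw [← (mem_corner.1 hn).2, M.form.rinner_rsmul]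
  by_cases hk : k = j
  · subst hk; simp
  · simp [hk]

theorem linner_eq_zero_of_ne {i j i' j' : ι} {m n : M.carrier} (hm : m ∈ M.corner i j)
    (hn : n ∈ M.corner i' j') (h : i ≠ i') : M.form.linner m n = 0 := by
  rw [linner_eq_single hm, ← M.form.star_linner, linner_eq_single hn]
  simp [h]

theorem rinner_eq_zero_of_ne {i j i' j' : ι} {m n : M.carrier} (hm : m ∈ M.corner i j)
    (hn : n ∈ M.corner i' j') (h : j ≠ j') : M.form.rinner m n = 0 := by
  rw [rinner_eq_single hn, ← M.form.star_rinner, rinner_eq_single hm]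
  simp [h.symm]

theorem linner_self_apply_ne_zero {i j : ι} {m : M.carrier} (hm : m ∈ M.corner i j)
    (h0 : m ≠ 0) : M.form.linner m m i ≠ 0 := fun h =>
  h0 (M.linner_definite m (by rw [linner_eq_single hm, h, Pi.single_zero]))

theorem rinner_self_apply_ne_zero {i j : ι} {m : M.carrier} (hm : m ∈ M.corner i j)
    (h0 : m ≠ 0) : M.form.rinner m m j ≠ 0 := fun h =>
  h0 (M.rinner_definite m (by rw [rinner_eq_single hm, h, Pi.single_zero]))

/-- If the rows differ, associativity for `n, m, m` has left side `0`, by orthogonality of distinct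
rows. Its right side is `n` times the non-zero scalar given by `⟨m, m⟩` at `j`. -/
theorem corner_left_unique {i i' j : ι} {m n : M.carrier} (hm : m ∈ M.corner i j) (hm0 : m ≠ 0)
    (hn : n ∈ M.corner i' j) (hn0 : n ≠ 0) : i = i' := by
  by_contra h
  have h1 := M.assoc n m m
  rw [linner_eq_zero_of_ne hn hm (Ne.symm h), rsmul_of_mem_corner hn, map_zero,
    LinearMap.zero_apply] at h1
  exact smul_ne_zero (rinner_self_apply_ne_zero hm hm0) hn0 h1.symm

/-- The mirror image, with associativity for `m, m, n`: now the right side vanishes and the left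
side is a non-zero multiple of `n`. -/
theorem corner_right_unique {i j j' : ι} {m n : M.carrier} (hm : m ∈ M.corner i j) (hm0 : m ≠ 0)
    (hn : n ∈ M.corner i j') (hn0 : n ≠ 0) : j = j' := by
  by_contra h
  have h1 := M.assoc m m n
  rw [rinner_eq_zero_of_ne hm hn h, lsmul_of_mem_corner hn, map_zero,
    LinearMap.zero_apply] at h1
  exact smul_ne_zero (linner_self_apply_ne_zero hm hm0) hn0 h1

/-- Non-zero corners are one-dimensional. -/
theorem exists_eq_smul_of_mem_corner {i j : ι} {m n : M.carrier} (hm : m ∈ M.corner i j)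
    (hm0 : m ≠ 0) (hn : n ∈ M.corner i j) : ∃ c : ℂ, n = c • m := by
  -- Inside one corner associativity reads `λ n = μ m`, where `λ ≠ 0` is the left squared length of
  -- `m`.
  have h1 := M.assoc m m n
  rw [lsmul_of_mem_corner hn, rsmul_of_mem_corner hm] at h1
  refine ⟨(M.form.linner m m i)⁻¹ * M.form.rinner m n j, ?_⟩
  rw [mul_smul, ← h1, inv_smul_smul₀ (linner_self_apply_ne_zero hm hm0)]

/-- Associativity for `m, m, m` equates the scalar values of the left and right inner products of
`m` with itself, so a single rescaling makes `m` a unit vector for both. -/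
theorem exists_unit_of_mem_corner {i j : ι} {m : M.carrier} (hm : m ∈ M.corner i j)
    (hm0 : m ≠ 0) : ∃ u ∈ M.corner i j, M.form.linner u u = Pi.single i 1 ∧
      M.form.rinner u u = Pi.single j 1 := by
  have h1 := M.assoc m m m
  rw [lsmul_of_mem_corner hm, rsmul_of_mem_corner hm] at h1
  have h2 := smul_left_injective ℂ hm0 h1
  have h3 := linner_self_apply_ne_zero hm hm0
  -- Positivity supplies a scalar `c i` whose squared modulus is the common squared length, so `(c
  -- i)⁻¹ • m` is normalized.
  obtain ⟨c, hc⟩ := M.form.linner_self m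
  have hc' : M.form.linner m m i = star (c i) * c i := by rw [hc]; rfl
  rw [hc'] at h2 h3
  have hl := linner_eq_single hm m
  have hr := rinner_eq_single hm m
  rw [hc'] at hl
  rw [← h2] at hr
  have h4 : c i ≠ 0 := right_ne_zero_of_mul h3
  have h5 : starRingEnd ℂ (c i) ≠ 0 := by simpa using h4
  refine ⟨(c i)⁻¹ • m, Submodule.smul_mem _ _ hm, ?_, ?_⟩
  all_goals
    simp only [map_smul, map_smulₛₗ, LinearMap.smul_apply, hl, hr, ← Pi.single_smul, smul_eq_mul,
      map_inv₀, ← starRingEnd_apply]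
    congr 1
    field_simp

variable (M) in
/-- The partial bijection of a bimodule `M` over `ℂ ^ ι`: it maps `j` to `i` if and only if
`e_i M e_j` is non-zero. -/
noncomputable def support : PartialBijection ι :=
  .ofRel (fun i j => ∃ m ∈ M.corner i j, m ≠ 0)
    (fun _ _ _ ⟨_, hm, hm0⟩ ⟨_, hn, hn0⟩ => corner_left_unique hm hm0 hn hn0)
    (fun _ _ _ ⟨_, hm, hm0⟩ ⟨_, hn, hn0⟩ => corner_right_unique hm hm0 hn hn0)

theorem support_eq_some {i j : ι} :
    PEquiv.toFun M.support j = some i ↔ ∃ m ∈ M.corner i j, m ≠ 0 :=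
  PartialBijection.mem_ofRel _ _

theorem Iso.support_eq {N : AssocHilbertBimodule (ι → ℂ) (ι → ℂ)} (f : Iso M N) :
    M.support = N.support := by
  -- Quantified over both bimodules so that it applies to `f` and to its inverse.
  have key : ∀ {M N : AssocHilbertBimodule (ι → ℂ) (ι → ℂ)} (f : Iso M N) (i j : ι),
      (∃ m ∈ M.corner i j, m ≠ 0) → ∃ m ∈ N.corner i j, m ≠ 0 := by
    rintro M N f i j ⟨m, hm, hm0⟩
    refine ⟨f.toEquiv m, ?_, by simpa using hm0⟩
    rw [mem_corner, ← f.map_lsmul, ← f.map_rsmul, (mem_corner.1 hm).1, (mem_corner.1 hm).2]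
    exact ⟨rfl, rfl⟩
  refine PartialBijection.ext fun i j => ?_
  rw [support_eq_some, support_eq_some]
  exact ⟨key f i j, key f.symm i j⟩

end Corner

/-! ### The support of a tensor product. -/

section Tensor

variable [Fintype ι] (M N : AssocHilbertBimodule (ι → ℂ) (ι → ℂ))

/-- The canonical map from the algebraic tensor product to `M ⊗_A N`. -/
noncomputable def tensorMk : M.carrier ⊗[ℂ] N.carrier →ₗ[ℂ] (M.tensor N).carrier :=
  (M.preTensor N).toCompl

theorem denseRange_tensorMk : DenseRange (M.tensorMk N) :=
  (M.preTensor N).denseRange_toCompl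

theorem lsmul_tensorMk_tmul (a : ι → ℂ) (m : M.carrier) (n : N.carrier) :
    (M.tensor N).form.lsmul a (M.tensorMk N (m ⊗ₜ n)) = M.tensorMk N (M.form.lsmul a m ⊗ₜ n) :=
  PreHilbertBimodule.complForm_lsmul (M.preTensor_nullAssoc N) a (m ⊗ₜ n)

theorem rsmul_tensorMk_tmul (b : ι → ℂ) (m : M.carrier) (n : N.carrier) :
    (M.tensor N).form.rsmul b (M.tensorMk N (m ⊗ₜ n)) = M.tensorMk N (m ⊗ₜ N.form.rsmul b n) :=
  PreHilbertBimodule.complForm_rsmul (M.preTensor_nullAssoc N) b (m ⊗ₜ n)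

theorem rinner_tensorMk_tmul (m m' : M.carrier) (n n' : N.carrier) :
    (M.tensor N).form.rinner (M.tensorMk N (m ⊗ₜ n)) (M.tensorMk N (m' ⊗ₜ n')) =
      N.form.rinner n (N.form.lsmul (M.form.rinner m m') n') :=
  PreHilbertBimodule.complForm_rinner (M.preTensor_nullAssoc N) (m ⊗ₜ n) (m' ⊗ₜ n')

theorem tensorMk_balanced (b : ι → ℂ) (m : M.carrier) (n : N.carrier) :
    M.tensorMk N (M.form.rsmul b m ⊗ₜ n) = M.tensorMk N (m ⊗ₜ N.form.lsmul b n) :=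
  PreHilbertBimodule.toCompl_eq fun w => M.preTensor_rinner_balanced N w b m n

variable [DecidableEq ι]

/-- Compressing `m ⊗ n` to the corner `(i, k)` gives `∑_j e_i m e_j ⊗ e_j n e_k`. If no `j` links
`i` to `k`, every term vanishes, and density extends this to the completion. If some `j` does, the
tensor product of unit vectors survives, because its inner product with itself is `e_k`. -/
theorem support_tensor : (M.tensor N).support = M.support * N.support := by
  refine PartialBijection.ext fun i k => ?_
  simp only [PartialBijection.mul_eq_some, support_eq_some]
  constructor
  · rintro ⟨x, hx, hx0⟩
    by_contra! hcon
    apply hx0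
    have key : ∀ t, (M.tensor N).form.rsmul (Pi.single k 1)
        ((M.tensor N).form.lsmul (Pi.single i 1) (M.tensorMk N t)) = 0 := by
      intro t
      induction t using TensorProduct.induction_on with
      | zero => simp only [map_zero]
      | add s t hs ht => simp only [map_add, hs, ht, add_zero]
      | tmul m n =>
        -- Insert `1 = ∑ e_j` in front of `n` and treat each `j` separately.
        rw [lsmul_tensorMk_tmul, rsmul_tensorMk_tmul, ← one_lsmul N n,
          ← Finset.univ_sum_single (1 : ι → ℂ), map_sum, LinearMap.sum_apply, map_sum,
          TensorProduct.tmul_sum, map_sum]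
        refine Finset.sum_eq_zero fun j _ => ?_
        -- The idempotent `e_j` is doubled so that one copy can cross the balanced tensor sign to
        -- `m` while the other stays with `n`; both factors then lie in corners.
        have h1 : ∀ n, N.form.lsmul (Pi.single j 1) n =
            N.form.lsmul (Pi.single j 1) (N.form.lsmul (Pi.single j 1) n) := fun n => by
          rw [← N.form.mul_lsmul, ← Pi.single_mul, one_mul]
        rw [Pi.one_apply, h1, N.form.lsmul_rsmul, ← tensorMk_balanced]
        by_cases h0 : M.form.rsmul (Pi.single j 1) (M.form.lsmul (Pi.single i 1) m) = 0
        · rw [h0, TensorProduct.zero_tmul, map_zero]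
        · rw [hcon j ⟨_, M.compress_mem_corner i j m, h0⟩ _ (N.compress_mem_corner j k n),
            TensorProduct.tmul_zero, map_zero]
    -- The compression is continuous and kills a dense subspace, hence kills `x`; but it fixes `x`,
    -- which lies in the corner.
    have h2 := dense_ext (M.denseRange_tensorMk N)
      (f := fun x => (M.tensor N).form.rsmul (Pi.single k 1)
        ((M.tensor N).form.lsmul (Pi.single i 1) x)) (g := fun _ => 0)
      (((M.tensor N).continuous_rsmul _).comp ((M.tensor N).continuous_lsmul _))
      continuous_const key x
    rwa [(mem_corner.1 hx).1, (mem_corner.1 hx).2] at h2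
  · rintro ⟨j, ⟨m, hm, hm0⟩, n, hn, hn0⟩
    obtain ⟨u, hu, -, hu'⟩ := exists_unit_of_mem_corner hm hm0
    obtain ⟨v, hv, -, hv'⟩ := exists_unit_of_mem_corner hn hn0
    refine ⟨M.tensorMk N (u ⊗ₜ v), ?_, fun h0 => ?_⟩
    · rw [mem_corner, lsmul_tensorMk_tmul, rsmul_tensorMk_tmul, (mem_corner.1 hu).1,
        (mem_corner.1 hv).2]
      exact ⟨rfl, rfl⟩
    · have h1 := M.rinner_tensorMk_tmul N u u v v
      -- `⟨u ⊗ v, u ⊗ v⟩ = ⟨v, e_j v⟩ = ⟨v, v⟩ = e_k`, whose value at `k` is `1`, not `0`.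
      rw [hu', (mem_corner.1 hv).1, hv', h0, map_zero] at h1
      have := congrFun h1 k
      simp at this

end Tensor

/-! ### Model bimodules: functions on a graph. -/

section Model

variable {T : Type}

/-- Extension by zero along a map of finite index sets, on complex functions. -/
noncomputable def push (l : T → ι) : (T → ℂ) →ₗ[ℂ] (ι → ℂ) :=
  Function.ExtendByZero.linearMap ℂ l

theorem push_apply {l : T → ι} (hl : Function.Injective l) (z : T → ℂ) (t : T) :
    push l z (l t) = z t :=
  hl.extend_apply _ _ _

theorem push_apply' {l : T → ι} (z : T → ℂ) {i : ι} (h : ¬ ∃ t, l t = i) : push l z i = 0 :=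
  Function.extend_apply' _ _ _ h

/-- Splits identities about `push` into the range of `l`, where `push` evaluates at the unique
preimage for injective `l`, and its complement, where `push` vanishes. -/
theorem fun_ext_of_range {l : T → ι} {a b : ι → ℂ} (h : ∀ t, a (l t) = b (l t))
    (h' : ∀ i, (¬ ∃ t, l t = i) → a i = b i) : a = b := by
  ext i
  by_cases hi : ∃ t, l t = i
  · obtain ⟨t, rfl⟩ := hi
    exact h t
  · exact h' i hi

/-- A projection formula: it makes the pushed-forward inner products linear over `ℂ ^ ι` in
`modelForm`. -/
theorem push_comp_mul {l : T → ι} (hl : Function.Injective l) (a : ι → ℂ) (z : T → ℂ) :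
    push l ((a ∘ l) * z) = a * push l z :=
  fun_ext_of_range (l := l) (fun t => by simp [push_apply hl])
    (fun i hi => by simp [push_apply' _ hi])

theorem star_push {l : T → ι} (hl : Function.Injective l) (z : T → ℂ) :
    star (push l z) = push l (star z) :=
  fun_ext_of_range (l := l) (fun t => by simp [push_apply hl])
    (fun i hi => by simp [push_apply' _ hi])

variable [Fintype ι]

/-- Extension by zero along an injection is a `*`-homomorphism, so it carries `star z * z` to the
square of `push l z`. -/
theorem isPos_push {l : T → ι} (hl : Function.Injective l) (z : T → ℂ) :
    IsPos (push l (star z * z)) :=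
  ⟨push l z, fun_ext_of_range (l := l) (fun t => by simp [push_apply hl])
    (fun i hi => by simp [push_apply' _ hi])⟩

variable [Fintype T]

theorem norm_push {l : T → ι} (hl : Function.Injective l) (z : T → ℂ) : ‖push l z‖ = ‖z‖ := by
  apply le_antisymm
  · refine (pi_norm_le_iff_of_nonneg (norm_nonneg _)).2 fun i => ?_
    by_cases hi : ∃ t, l t = i
    · obtain ⟨t, rfl⟩ := hi
      rw [push_apply hl]
      exact norm_le_pi_norm z t
    · rw [push_apply' _ hi, norm_zero]
      exact norm_nonneg _
  · refine (pi_norm_le_iff_of_nonneg (norm_nonneg _)).2 fun t => ?_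
    rw [← push_apply hl z t]
    exact norm_le_pi_norm (push l z) (l t)

/-- The forms of the bimodule of functions on `T`, for injective maps `l r : T → ι`. -/
noncomputable def modelForm {l r : T → ι} (hl : Function.Injective l)
    (hr : Function.Injective r) : PreHilbertBimodule (ι → ℂ) (ι → ℂ) (T → ℂ) where
  lsmul := LinearMap.mk₂ ℂ (fun a x => (a ∘ l) * x) (fun _ _ _ => add_mul _ _ _)
    (fun c a x => smul_mul_assoc c (_ ∘ _) x) (fun _ _ _ => mul_add _ _ _)
    (fun _ _ _ => mul_smul_comm _ _ _)
  rsmul := LinearMap.mk₂ ℂ (fun b x => (b ∘ r) * x) (fun _ _ _ => add_mul _ _ _)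
    (fun c a x => smul_mul_assoc c (_ ∘ _) x) (fun _ _ _ => mul_add _ _ _)
    (fun _ _ _ => mul_smul_comm _ _ _)
  linner := LinearMap.mk₂'ₛₗ (RingHom.id ℂ) (starRingEnd ℂ) (fun x y => push l (star y * x))
    (by simp [mul_add]) (by simp) (by simp [add_mul]) (by simp)
  rinner := LinearMap.mk₂'ₛₗ (starRingEnd ℂ) (RingHom.id ℂ) (fun x y => push r (star x * y))
    (by simp [add_mul]) (by simp) (by simp [mul_add]) (by simp)
  mul_lsmul a b m := by ext t; simp [mul_assoc]
  mul_rsmul a b m := by ext t; simp [mul_assoc, mul_left_comm]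
  lsmul_rsmul a b m := by ext t; simp [mul_left_comm]
  linner_lsmul a m n := by simp [← push_comp_mul hl, mul_left_comm]
  star_linner m n := by simp [star_push hl, mul_comm]
  linner_self m := isPos_push hl m
  rinner_rsmul a m n := by rw [mul_comm]; simp [← push_comp_mul hr, mul_left_comm]
  star_rinner m n := by simp [star_push hr, mul_comm]
  rinner_self m := isPos_push hr m
  rinner_lsmul a m n := congrArg (push r) (by ext t; simp; ring)
  linner_rsmul a m n := congrArg (push l) (by ext t; simp; ring)

/-- The associative Hilbert C*-bimodule of functions on `T`, for injective maps `l r : T → ι`. -/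
noncomputable def model {l r : T → ι} (hl : Function.Injective l) (hr : Function.Injective r) :
    AssocHilbertBimodule (ι → ℂ) (ι → ℂ) :=
  -- As `push` is isometric, the C*-identity makes both inner product norms equal to the sup norm.
  -- This yields definiteness, and norm equivalence with constants `1`.
  have hL : ∀ m : T → ℂ, √‖(modelForm hl hr).linner m m‖ = ‖m‖ := fun m => by
    change √‖push l (star m * m)‖ = _
    rw [norm_push hl, CStarRing.norm_star_mul_self, Real.sqrt_mul_self (norm_nonneg _)]
  have hR : ∀ m : T → ℂ, √‖(modelForm hl hr).rinner m m‖ = ‖m‖ := fun m => by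
    change √‖push r (star m * m)‖ = _
    rw [norm_push hr, CStarRing.norm_star_mul_self, Real.sqrt_mul_self (norm_nonneg _)]
  { carrier := T → ℂ
    form := modelForm hl hr
    linner_definite := fun m h => by rw [← norm_eq_zero, ← hL, h]; simp
    rinner_definite := fun m h => by rw [← norm_eq_zero, ← hR, h]; simp
    dense_lsmul := fun m => subset_closure (Submodule.subset_span ⟨1, m, by
      change ((1 : ι → ℂ) ∘ l) * m = m
      ext; simp⟩)
    dense_rsmul := fun m => subset_closure (Submodule.subset_span ⟨1, m, by
      change ((1 : ι → ℂ) ∘ r) * m = m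
      ext; simp⟩)
    norm_equiv_left := ⟨1, 1, one_pos, fun m => by simp [hL]⟩
    norm_equiv_right := ⟨1, 1, one_pos, fun m => by simp [hR]⟩
    assoc := fun m n k => by
      -- Pushing along an injection and restricting back is the identity, so at `t` both sides are
      -- the product of `m t`, the conjugate of `n t`, and `k t`.
      change (push l (star n * m) ∘ l) * k = (push r (star n * k) ∘ r) * m
      ext t
      simp only [Pi.mul_apply, Function.comp_apply, push_apply hl, push_apply hr]
      ring }

variable [DecidableEq ι]

/-- The point mass at `t` lies in the corner `(l t, r t)`. Conversely, a vector fixed by `e_i` on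
the left and `e_j` on the right can be non-zero at `t` only if `l t = i` and `r t = j`. -/
theorem support_model {l r : T → ι} (hl : Function.Injective l) (hr : Function.Injective r)
    (i j : ι) : PEquiv.toFun (model hl hr).support j = some i ↔ ∃ t, l t = i ∧ r t = j := by
  classical
  rw [support_eq_some]
  constructor
  · rintro ⟨m, hm, hm0⟩
    obtain ⟨t, ht⟩ := Function.ne_iff.1 hm0
    have h1 : Pi.single (M := fun _ => ℂ) i 1 (l t) * m t = m t := congrFun (mem_corner.1 hm).1 t
    have h2 : Pi.single (M := fun _ => ℂ) j 1 (r t) * m t = m t := congrFun (mem_corner.1 hm).2 t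
    refine ⟨t, ?_, ?_⟩
    · by_contra h
      rw [Pi.single_eq_of_ne h, zero_mul] at h1
      exact ht h1.symm
    · by_contra h
      rw [Pi.single_eq_of_ne h, zero_mul] at h2
      exact ht h2.symm
  · rintro ⟨t, rfl, rfl⟩
    refine ⟨(Pi.single t 1 : T → ℂ), mem_corner.2 ⟨?_, ?_⟩, ?_⟩
    · change (Pi.single (l t) 1 ∘ l) * (Pi.single t 1 : T → ℂ) = Pi.single t 1
      ext s
      by_cases hs : s = t
      · subst hs; simp
      · simp [hs]
    · change (Pi.single (r t) 1 ∘ r) * (Pi.single t 1 : T → ℂ) = Pi.single t 1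
      ext s
      by_cases hs : s = t
      · subst hs; simp
      · simp [hs]
    · exact fun h => one_ne_zero ((Pi.single_eq_zero_iff).1 h)

/-- A bimodule whose support has graph `T` is isomorphic to the bimodule of functions on `T`. -/
theorem nonempty_iso_model (M : AssocHilbertBimodule (ι → ℂ) (ι → ℂ)) {l r : T → ι}
    (hl : Function.Injective l) (hr : Function.Injective r)
    (h : ∀ i j, PEquiv.toFun M.support j = some i ↔ ∃ t, l t = i ∧ r t = j) :
    Nonempty (Iso (model hl hr) M) := by
  -- The isomorphism will send the point mass at `t` to a unit vector `u t` of the corresponding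
  -- corner.
  have hu : ∀ t, ∃ u ∈ M.corner (l t) (r t), M.form.linner u u = Pi.single (l t) 1 ∧
      M.form.rinner u u = Pi.single (r t) 1 := fun t => by
    obtain ⟨m, hm, hm0⟩ := support_eq_some.1 ((h (l t) (r t)).2 ⟨t, rfl, rfl⟩)
    exact exists_unit_of_mem_corner hm hm0
  choose u hu huL huR using hu
  have hne : ∀ t, u t ≠ 0 := fun t h0 => by
    have := congrFun (huL t) (l t)
    simp [h0] at this
  let F : (T → ℂ) →ₗ[ℂ] M.carrier := Fintype.linearCombination ℂ u
  have hF : ∀ x, F x = ∑ t, x t • u t := fun x => rfl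
  have hFL : ∀ x y, M.form.linner (F x) (F y) = push l (star y * x) := fun x y => by
    -- Injectivity of `l` puts distinct `u s` in distinct rows; injectivity of `r` plays the same
    -- role for columns in `hFR`.
    have h0 : ∀ s t, s ≠ t → M.form.linner (u s) (u t) = 0 := fun s t hst =>
      linner_eq_zero_of_ne (hu s) (hu t) (hl.ne hst)
    have h1 : ∀ s, ∑ t, M.form.linner (x s • u s) (y t • u t) =
        Pi.single (l s) (star (y s) * x s) := fun s => by
      rw [Finset.sum_eq_single s (fun t _ hts => by simp [h0 s t hts.symm]) (by simp)]
      simp [huL, ← Pi.single_smul]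
    simp only [hF, map_sum, LinearMap.sum_apply]
    rw [Finset.sum_comm, Finset.sum_congr rfl fun s _ => h1 s]
    refine fun_ext_of_range (l := l) (fun t => ?_) (fun i hi => ?_)
    · rw [push_apply hl, Finset.sum_apply,
        Finset.sum_eq_single t (fun s _ hst => by simp [hl.eq_iff, hst.symm]) (by simp)]
      simp
    · rw [push_apply' _ hi, Finset.sum_apply]
      exact Finset.sum_eq_zero fun t _ => Pi.single_eq_of_ne (fun e => hi ⟨t, e.symm⟩) _
  have hFR : ∀ x y, M.form.rinner (F x) (F y) = push r (star x * y) := fun x y => by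
    have h0 : ∀ s t, s ≠ t → M.form.rinner (u s) (u t) = 0 := fun s t hst =>
      rinner_eq_zero_of_ne (hu s) (hu t) (hr.ne hst)
    have h1 : ∀ s, ∑ t, M.form.rinner (x s • u s) (y t • u t) =
        Pi.single (r s) (star (x s) * y s) := fun s => by
      rw [Finset.sum_eq_single s (fun t _ hts => by simp [h0 s t hts.symm]) (by simp)]
      simp [huR, ← Pi.single_smul, mul_comm]
    simp only [hF, map_sum, LinearMap.sum_apply]
    rw [Finset.sum_comm, Finset.sum_congr rfl fun s _ => h1 s]
    refine fun_ext_of_range (l := r) (fun t => ?_) (fun i hi => ?_)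
    · rw [push_apply hr, Finset.sum_apply,
        Finset.sum_eq_single t (fun s _ hst => by simp [hr.eq_iff, hst.symm]) (by simp)]
      simp
    · rw [push_apply' _ hi, Finset.sum_apply]
      exact Finset.sum_eq_zero fun t _ => Pi.single_eq_of_ne (fun e => hi ⟨t, e.symm⟩) _
  have hinj : Function.Injective F := by
    rw [← LinearMap.ker_eq_bot, LinearMap.ker_eq_bot']
    intro x hx
    -- `F` preserves the left inner product, so definiteness on the model gives a trivial kernel.
    refine (model hl hr).linner_definite x ?_
    have h1 := hFL x x
    rw [hx, map_zero] at h1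
    exact h1.symm
  have hsurj : Function.Surjective F := by
    rw [← LinearMap.range_eq_top, eq_top_iff]
    intro m _
    -- By the Peirce decomposition it suffices to reach each corner component, and each is zero or a
    -- multiple of some `u t`.
    rw [← M.sum_compress m]
    refine sum_mem fun i _ => sum_mem fun j _ => ?_
    have hm := M.compress_mem_corner i j m
    by_cases h0 : M.form.rsmul (Pi.single j 1) (M.form.lsmul (Pi.single i 1) m) = 0
    · rw [h0]
      exact zero_mem _
    · obtain ⟨t, rfl, rfl⟩ := (h i j).1 (support_eq_some.2 ⟨_, hm, h0⟩)
      obtain ⟨c, hc⟩ := exists_eq_smul_of_mem_corner (hu t) (hne t) hm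
      classical
      refine ⟨Pi.single t c, ?_⟩
      rw [hc]
      exact Fintype.linearCombination_apply_single ℂ u t c
  refine ⟨⟨LinearEquiv.ofBijective F ⟨hinj, hsurj⟩, fun a (m : T → ℂ) => ?_,
    fun a (m : T → ℂ) => ?_, hFL, hFR⟩⟩
  · change F ((a ∘ l) * m) = M.form.lsmul a (F m)
    simp [hF, lsmul_of_mem_corner (hu _), smul_smul, mul_comm]
  · change F ((a ∘ r) * m) = M.form.rsmul a (F m)
    simp [hF, rsmul_of_mem_corner (hu _), smul_smul, mul_comm]

end Model

/-! ### Classification by the support, and the isomorphism of semigroups. -/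

section Classification

variable [Fintype ι] [DecidableEq ι]

/-- A bimodule over `ℂ ^ ι` is determined by its support. -/
theorem nonempty_iso_of_support_eq {M N : AssocHilbertBimodule (ι → ℂ) (ι → ℂ)}
    (h : M.support = N.support) : Nonempty (Iso M N) := by
  -- Both bimodules are compared with the same model, the functions on the common graph of their
  -- supports.
  let T := {p : ι × ι // PEquiv.toFun M.support p.2 = some p.1}
  have : Fintype T := Fintype.ofFinite T
  obtain ⟨f⟩ := nonempty_iso_model M (PartialBijection.injective_fst_graph M.support)
    (PartialBijection.injective_snd_graph M.support)
    (PartialBijection.eq_some_iff_exists_graph M.support)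
  obtain ⟨g⟩ := nonempty_iso_model N (PartialBijection.injective_fst_graph M.support)
    (PartialBijection.injective_snd_graph M.support)
    (h ▸ PartialBijection.eq_some_iff_exists_graph M.support)
  exact ⟨f.symm.trans g⟩

theorem exists_support_eq (f : PartialBijection ι) :
    ∃ M : AssocHilbertBimodule (ι → ℂ) (ι → ℂ), M.support = f := by
  have : Fintype {p : ι × ι // PEquiv.toFun f p.2 = some p.1} := Fintype.ofFinite _
  refine ⟨model (PartialBijection.injective_fst_graph f) (PartialBijection.injective_snd_graph f),
    PartialBijection.ext fun i j => ?_⟩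
  rw [support_model, PartialBijection.eq_some_iff_exists_graph f]

end Classification

end AssocHilbertBimodule

namespace BimoduleSemigroup

variable {ι : Type} [Fintype ι] [DecidableEq ι]

/-- The partial bijection of an isomorphism class of bimodules over `ℂ ^ ι`. -/
noncomputable def support : BimoduleSemigroup (ι → ℂ) →ₙ* PartialBijection ι where
  toFun := Quotient.lift (fun M => AssocHilbertBimodule.support M) fun _ _ ⟨f⟩ => f.support_eq
  -- On representatives the product of classes is the class of the tensor product by definition.
  map_mul' x y := Quotient.inductionOn₂ x y fun M N => M.support_tensor N

theorem bijective_support : Function.Bijective (support (ι := ι)) := by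
  constructor
  · intro x y
    induction x using Quotient.inductionOn
    induction y using Quotient.inductionOn
    exact fun h => Quotient.sound (AssocHilbertBimodule.nonempty_iso_of_support_eq h)
  · intro f
    obtain ⟨M, hM⟩ := AssocHilbertBimodule.exists_support_eq f
    exact ⟨Quotient.mk _ M, hM⟩

end BimoduleSemigroup

end CStarBimod

/-- The case `n = 0` needs no separate treatment: there `1 = 0` in the algebra, so `one_lsmul`
forces every bimodule to be zero, matching the single empty partial bijection. -/
theorem mainTheorem6 (n : ℕ) :
    Nonempty (CStarBimod.BimoduleSemigroup (Fin n → ℂ) ≃*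
      CStarBimod.PartialBijection (Fin n)) :=
  ⟨MulEquiv.ofBijective _ CStarBimod.BimoduleSemigroup.bijective_support⟩
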